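/- **Setting.** Let $d,n\ge 0$, $m\ge 1$, let $\mathcal X\subset\mathbb R^d$ be a finite set, and let $g_i(x,\cdot):\mathbb R^m\to\mathbb R$ ($x\in\mathcal X$, $i=0,\dots,n$) satisfy $|g_i(x,y)-g_i(x,z)|\le L_i\|y-z\|_1$. Let $h:\mathcal X\to\mathbb R^m$ be a sample of a Gaussian process with mean $\mu_0$ and matrix-valued positive semidefinite covariance function $K_0$, whose diagonal entries $k_{j,0}$ satisfy $k_{j,0}(x,x)\le 1$. Put $f_i(x)=g_i(x,h(x))$ and consider $$\max_{x\in\mathcal X} f_0(x)\quad\text{subject to}\quad f_i(x)\ge 0,\ i=1,\dots,n. \qquad (\mathrm P)$$ A query at $x_t$ returns $y_t=h(x_t)+\epsilon_t$ with $\epsilon_1,\epsilon_2,\dots$ i.i.d. $\mathcal N(0,\sigma^2 I_m)$, independent of $h$. Fix $T\ge 1$ and $\delta\in(0,1)$ and let $0<\sigma^2\le 1+2/T$. Given $\mathcal D_t=\{(x_s,y_s)\}_{s\le t}$, let $\mathcal N(\mu_t(x),\Sigma_t(x))$ be the usual Gaussian process posterior of $h(x)$, let $Y_{i,t}(x)=g_i(x,W)$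 with $W\sim\mathcal N(\mu_t(x),\Sigma_t(x))$, and let $Q_Y(p)=\inf\{y:\Pr(Y\le y)\ge p\}$. With $\alpha_t=6\delta/(\pi^2(t+1)^2(n+1)|\mathcal X|)$ put $l_{i,t}(x)=Q_{Y_{i,t}(x)}(\alpha_t/2)$ and $u_{i,t}(x)=Q_{Y_{i,t}(x)}(1-\alpha_t/2)$. At step $t=0,1,\dots,T-1$ the algorithm (CUQB) declares infeasibility and stops if $\max_{x\in\mathcal X}u_{i,t}(x)<0$ for some $i\ge 1$; otherwise it queries a maximizer $x_{t+1}$ of $u_{0,t}$ over $\{x\in\mathcal X:u_{i,t}(x)\ge 0,\ i=1,\dots,n\}$, chosen as a measurable function of $\mathcal D_t$. For a penalty parameter $\rho$, a recommended point $\tilde x^r_T(\rho)$ is any $x_{t^\star}$ such that $t^\star$ maximizes $l_{0,t-1}(x_t)-\rho\sum_{i=1}^n[-l_{i,t-1}(x_t)]^+$ over $t\in\{1,\dots,T\}$, where $[a]^+=\max\{a,0\}$. Let $\gamma_{j,T}=\max_{a_1,\dots,a_T\in\mathcal X}\tfrac12\log\det\big(I+\sigma^{-2}[k_{j,0}(a_s,a_{s'})]_{s,s'\le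 T}\big)$ (repetitions allowed), $\Psi_T=\sum_{j=1}^m\sqrt{(T+2)\gamma_{j,T}}$ and $\beta_T=2\log\big(m\pi^2T^2(n+1)|\mathcal X|/(3\delta)\big)$. **Theorem.** There is an event of probability at least $1-\delta$ on which the following holds whenever the realized problem $(\mathrm P)$ is feasible, with optimal value $f_0^\star$. At none of the steps $t<T$ is infeasibility declared, and the problem defining $x_{t+1}$ is feasible at each of them. Moreover, if $\bar\rho\ge 0$ is such that for every $\rho\ge\bar\rho$ the function $f_0-\rho\sum_{i=1}^n[-f_i]^+$ is an exact penalty function for $(\mathrm P)$ (every solution of $(\mathrm P)$ maximizes it over $\mathcal X$; equivalently, it is at most $f_0^\star$ on $\mathcal X$), then for all $\rho\ge\bar\rho$ and every recommended point $\tilde x^r_T=\tilde x^r_T(\rho)$ $$0\le f_0^\star-f_0(\tilde x_T^r)+\rho\sum_{i=1}^n[-f_i(\tilde x_T^r)]^+\le\frac{4\big(L_0+\rho\sum_{i=1}^nL_i\big)\beta_T^{1/2}\,\Psi_T}{T}.$$ -/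

import Mathlib

open MeasureTheory ProbabilityTheory

noncomputable section

namespace CUQB

/-! ### Constrained optimization on a finite candidate set

A problem with objective `f 0` (to be maximized) and constraints `f i.succ x ≥ 0`, `i : Fin n`. -/

section Problem

variable {𝒳 : Type*} {n : ℕ}

/-- `x` satisfies all the constraints `f 1, …, f n ≥ 0`. -/
def IsFeasible (f : Fin (n + 1) → 𝒳 → ℝ) (x : 𝒳) : Prop :=
  ∀ i : Fin n, 0 ≤ f i.succ x

/-- `x` is a global solution of `max f 0` subject to `f 1, …, f n ≥ 0`. -/
def IsSolution (f : Fin (n + 1) → 𝒳 → ℝ) (x : 𝒳) : Prop :=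
  IsFeasible f x ∧ ∀ z, IsFeasible f z → f 0 z ≤ f 0 x

/-- The total constraint violation `∑ i, [-f i x]⁺`. -/
def violation (f : Fin (n + 1) → 𝒳 → ℝ) (x : 𝒳) : ℝ :=
  ∑ i : Fin n, max (-(f i.succ x)) 0

/-- The penalty function `f 0 x - ρ * ∑ i, [-f i x]⁺`. -/
def penalized (f : Fin (n + 1) → 𝒳 → ℝ) (ρ : ℝ) (x : 𝒳) : ℝ :=
  f 0 x - ρ * violation f x

/-- The penalty function with parameter `ρ` is exact: every solution of the constrained problem
is a global maximizer of the penalty function over the whole candidate set (for a feasible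
problem: the penalty function nowhere exceeds the constrained optimal value). -/
def IsExactPenalty (f : Fin (n + 1) → 𝒳 → ℝ) (ρ : ℝ) : Prop :=
  ∀ x, IsSolution f x → ∀ z, penalized f ρ z ≤ penalized f ρ x

end Problem

/-! ### The model and its Gaussian process posterior -/

/-- Data of a grey-box problem with Gaussian process prior: prior mean `μ₀`, prior covariance
function `K₀` (`K₀ (x, j) (x', j')` is the entry `(j, j')` of the matrix `K₀(x, x')`),
noise standard deviation `σ`, and the known outer functions `g i`. -/
structure Model (𝒳 : Type*) (n m : ℕ) where
  μ₀ : 𝒳 → Fin m → ℝ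
  K₀ : Matrix (𝒳 × Fin m) (𝒳 × Fin m) ℝ
  σ : ℝ
  g : Fin (n + 1) → 𝒳 → (Fin m → ℝ) → ℝ

/-- A list of `t` query points with the corresponding observations. -/
abbrev Data (𝒳 : Type*) (m t : ℕ) := Fin t → 𝒳 × (Fin m → ℝ)

/-- The generalized inverse `inf {y | F y ≥ p}` of the distribution function of `ν`. -/
def quantile (ν : Measure ℝ) (p : ℝ) : ℝ :=
  sInf {y : ℝ | p ≤ ν.real (Set.Iic y)}

namespace Model

variable {𝒳 : Type*} {n m t : ℕ} (M : Model 𝒳 n m)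

/-- The composite functions `f i x = g i x (h x)`. -/
def f (h : 𝒳 → Fin m → ℝ) : Fin (n + 1) → 𝒳 → ℝ :=
  fun i x => M.g i x (h x)

/-- Prior covariance of the (noise-free) values at the query points. -/
def gram (D : Data 𝒳 m t) : Matrix (Fin t × Fin m) (Fin t × Fin m) ℝ :=
  Matrix.of fun p q => M.K₀ ((D p.1).1, p.2) ((D q.1).1, q.2)

/-- Prior covariance between the values at the query points and the value at `x`. -/
def crossCov (D : Data 𝒳 m t) (x : 𝒳) : Matrix (Fin t × Fin m) (Fin m) ℝ :=
  Matrix.of fun p j => M.K₀ ((D p.1).1, p.2) (x, j)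

/-- Posterior mean `μ_t(x)`. -/
def postMean (D : Data 𝒳 m t) (x : 𝒳) : Fin m → ℝ :=
  M.μ₀ x + Matrix.mulVec ((M.crossCov D x).transpose * (M.gram D + M.σ ^ 2 • 1)⁻¹)
    (fun p => (D p.1).2 p.2 - M.μ₀ (D p.1).1 p.2)

/-- Posterior covariance `Σ_t(x) = K_t(x, x)`. -/
def postCov (D : Data 𝒳 m t) (x : 𝒳) : Matrix (Fin m) (Fin m) ℝ :=
  Matrix.of (fun j k => M.K₀ (x, j) (x, k)) -
    (M.crossCov D x).transpose * (M.gram D + M.σ ^ 2 • 1)⁻¹ * M.crossCov D x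

/-- The law of the posterior prediction `Y_{i,t}(x) = g i x (μ_t(x) + Σ_t(x)^{1/2} Z)`. -/
def predLaw (D : Data 𝒳 m t) (i : Fin (n + 1)) (x : 𝒳) : Measure ℝ :=
  (multivariateGaussian (WithLp.toLp 2 (M.postMean D x)) (M.postCov D x)).map
    (fun z => M.g i x z.ofLp)

variable [Fintype 𝒳]

/-- The probability level `α_{i,t} = 6 δ / (π² (t+1)² (n+1) |𝒳|)`. -/
def level (_M : Model 𝒳 n m) (δ : ℝ) (t : ℕ) : ℝ :=
  6 * δ / (Real.pi ^ 2 * ((t : ℝ) + 1) ^ 2 * ((n : ℝ) + 1) * (Fintype.card 𝒳 : ℝ))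

/-- The lower quantile bound `l_{i,t}(x)` given the data `D`. -/
def lower (δ : ℝ) (D : Data 𝒳 m t) : Fin (n + 1) → 𝒳 → ℝ :=
  fun i x => quantile (M.predLaw D i x) (M.level δ t / 2)

/-- The upper quantile bound `u_{i,t}(x)` given the data `D`. -/
def upper (δ : ℝ) (D : Data 𝒳 m t) : Fin (n + 1) → 𝒳 → ℝ :=
  fun i x => quantile (M.predLaw D i x) (1 - M.level δ t / 2)

/-- Infeasibility is declared on the data `D`: some constraint has `max_x u_{i,t}(x) < 0`. -/
def DeclaresInfeasible (δ : ℝ) (D : Data 𝒳 m t) : Prop :=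
  ∃ i : Fin n, ∀ x, M.upper δ D i.succ x < 0

/-- Maximum information gain `γ_{j,T}` of output `j` from `T` noisy measurements; the query points
may repeat, as they may in the algorithm. -/
def infoGain (j : Fin m) (T : ℕ) : ℝ :=
  ⨆ a : Fin T → 𝒳, (1 / 2 : ℝ) * Real.log
    (1 + (M.σ ^ 2)⁻¹ • Matrix.of (fun s s' : Fin T => M.K₀ (a s, j) (a s', j))).det

/-- `Ψ_T = ∑ j, √((T + 2) γ_{j,T})`. -/
def Psi (T : ℕ) : ℝ :=
  ∑ j : Fin m, Real.sqrt (((T : ℝ) + 2) * M.infoGain j T)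

/-- `β_T = 2 log (m π² T² (n+1) |𝒳| / (3 δ))`. -/
def beta (_M : Model 𝒳 n m) (δ : ℝ) (T : ℕ) : ℝ :=
  2 * Real.log ((m : ℝ) * Real.pi ^ 2 * (T : ℝ) ^ 2 * ((n : ℝ) + 1) * (Fintype.card 𝒳 : ℝ)
    / (3 * δ))

open Classical in
/-- The random function `h` is a Gaussian process on `𝒳` with mean `μ₀` and covariance `K₀`. -/
def IsGPSample {Ω : Type*} [MeasurableSpace Ω] (P : Measure Ω)
    (h : Ω → 𝒳 → Fin m → ℝ) : Prop :=
  HasLaw (fun ω => WithLp.toLp 2 (fun p : 𝒳 × Fin m => h ω p.1 p.2))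
    (multivariateGaussian (WithLp.toLp 2 (fun p : 𝒳 × Fin m => M.μ₀ p.1 p.2)) M.K₀) P

/-- The noise vectors `ε t` are i.i.d. `N(0, σ² I_m)`. -/
def IsNoise {Ω : Type*} [MeasurableSpace Ω] (P : Measure Ω)
    (ε : ℕ → Ω → Fin m → ℝ) : Prop :=
  iIndepFun ε P ∧
    ∀ t, HasLaw (fun ω => WithLp.toLp 2 (ε t ω)) (multivariateGaussian 0 (M.σ ^ 2 • 1)) P

end Model

/-! ### The sequential algorithm -/

/-- A sampling rule: the next query point as a function of the data collected so far. -/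
abbrev Rule (𝒳 : Type*) (m : ℕ) := (t : ℕ) → Data 𝒳 m t → 𝒳

/-- The data after `t` steps, for the unknown function `h` and the noise sequence `ε`
(`ε t` is the noise of the step that leads from `t` to `t + 1` data points). -/
def runData {𝒳 : Type*} {m : ℕ} (A : Rule 𝒳 m) (h : 𝒳 → Fin m → ℝ) (ε : ℕ → Fin m → ℝ) :
    (t : ℕ) → Data 𝒳 m t
  | 0 => fun s => s.elim0
  | t + 1 => Fin.snoc (α := fun _ => 𝒳 × (Fin m → ℝ)) (runData A h ε t)
      (A t (runData A h ε t), h (A t (runData A h ε t)) + ε t)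

/-- The point `x_{t+1}` queried on the basis of the data after `t` steps. -/
def query {𝒳 : Type*} {m : ℕ} (A : Rule 𝒳 m) (h : 𝒳 → Fin m → ℝ) (ε : ℕ → Fin m → ℝ) (t : ℕ) :
    𝒳 :=
  A t (runData A h ε t)

namespace Model

variable {𝒳 : Type*} {n m : ℕ} (M : Model 𝒳 n m) [Fintype 𝒳]

/-- `A` is a (measurable) CUQB rule: whenever the auxiliary problem
`max u_{0,t}` s.t. `u_{1,t}, …, u_{n,t} ≥ 0` is feasible, it selects one of its global solutions.
On data for which the auxiliary problem is infeasible (where the algorithm does not continue, and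
in particular whenever infeasibility is declared) the value of `A` is arbitrary. -/
def IsCUQBRule [MeasurableSpace 𝒳] (δ : ℝ) (A : Rule 𝒳 m) : Prop :=
  (∀ t, Measurable (A t)) ∧
    ∀ (t : ℕ) (D : Data 𝒳 m t), (∃ x, IsFeasible (M.upper δ D) x) →
      IsSolution (M.upper δ D) (A t D)

/-- `x_{τ+1}` is a recommended point after `T` steps with penalty parameter `ρ`: `τ` maximizes
`l_{0,t}(x_{t+1}) - ρ ∑ i, [-l_{i,t}(x_{t+1})]⁺` over `t = 0, …, T - 1`. -/
def IsRecommended (δ : ℝ) (A : Rule 𝒳 m) (h : 𝒳 → Fin m → ℝ) (ε : ℕ → Fin m → ℝ)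
    (T : ℕ) (ρ : ℝ) (τ : ℕ) : Prop :=
  τ < T ∧ ∀ t < T,
    penalized (M.lower δ (runData A h ε t)) ρ (query A h ε t) ≤
      penalized (M.lower δ (runData A h ε τ)) ρ (query A h ε τ)

end Model

end CUQB

end

/-! The argument is optimism under a confidence event, with quantiles in place of the usual mean
plus or minus a multiple of the standard deviation.

Confidence. For a fixed design, the observations and `h x` are jointly Gaussian, so `h x` minus its
posterior mean is independent of the observations and has law `N(0, Σ_t(x))` (`posterior_residual`).
Conditionally on the observations, `f i x` therefore has law `predLaw` and leaves `[l, u]` with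
probability at most `α_t`. The actual design is adaptive, but it takes finitely many values, and the
event that it equals `a` is determined by the observations at `a`. Summing over these disjoint
events transfers the bound without loss (`measure_runData_le`). A union bound over `t`, `i`, `x`
costs at most `δ`, because `∑ 1/(t+1)² ≤ π²/6` (`exists_confidence_event`).

Regret. On this event a solution of the true problem stays feasible for the upper bounds, so
infeasibility is never declared. The queried point has `u_0 ≥ f_0^⋆` and `u_i ≥ 0`, hence its
penalized lower bound falls short of `f_0^⋆` by at most a weighted sum of widths `u_i - l_i`
(`optimum_sub_penalized_lower_le`). A Gaussian tail bound and the Lipschitz condition bound each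
width by `2 L_i √β_T` times the sum of the posterior standard deviations (`upper_sub_lower_le`).

Information gain. Each posterior variance is at most the variance given the observations of that
output alone, and these variances are the successive pivots in the determinant defining `γ_{j,T}`.
With Cauchy–Schwarz, the standard deviations along the run sum to at most `2 Ψ_T`
(`sum_sqrt_outputVar_le`). The recommended point is at least as good as the average step, which
gives the rate `1/T`. The event does not involve `ρ`, so all penalty parameters are covered at once;
exactness gives the nonnegativity of the penalized regret. -/

namespace CUQB

open Set Filter Topology

/-! ### Quantiles -/

section Quantile

variable {ν : Measure ℝ} [IsProbabilityMeasure ν] {p : ℝ}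

/-- Right continuity of the distribution function makes the infimum attained. The bounds on `p` make
the set nonempty and bounded below, so `sInf` never takes its default value. -/
theorem quantile_le_iff (hp0 : 0 < p) (hp1 : p < 1) {c : ℝ} :
    quantile ν p ≤ c ↔ p ≤ ν.real (Iic c) := by
  have hmono : Monotone fun y => ν.real (Iic y) := fun a b hab =>
    measureReal_mono (Iic_subset_Iic.2 hab)
  have hcdf : (fun y => ν.real (Iic y)) = cdf ν := by
    ext y
    rw [cdf_eq_real]
  have hne : {y : ℝ | p ≤ ν.real (Iic y)}.Nonempty := by
    have := (tendsto_cdf_atTop ν).eventually (eventually_gt_nhds hp1)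
    obtain ⟨y, hy⟩ := this.exists
    exact ⟨y, by rw [← hcdf] at hy; exact hy.le⟩
  have hbdd : BddBelow {y : ℝ | p ≤ ν.real (Iic y)} := by
    have := (tendsto_cdf_atBot ν).eventually (eventually_lt_nhds hp0)
    obtain ⟨y, hy⟩ := this.exists
    refine ⟨y, fun z hz => ?_⟩
    by_contra! hlt
    rw [← hcdf] at hy
    exact absurd (hz.trans (hmono hlt.le)) (not_le.2 hy)
  refine ⟨fun h => ?_, fun h => csInf_le hbdd h⟩
  have hright : ContinuousWithinAt (fun y => ν.real (Iic y)) (Ioi c) c := by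
    rw [hcdf]
    exact ((cdf ν).right_continuous c).mono Ioi_subset_Ici_self
  refine ge_of_tendsto hright ?_
  filter_upwards [self_mem_nhdsWithin] with z hz
  obtain ⟨y, hy, hyz⟩ := exists_lt_of_csInf_lt hne (h.trans_lt hz)
  exact le_trans hy (hmono hyz.le)

theorem measureReal_Ioi_quantile_le (hp0 : 0 < p) (hp1 : p < 1) :
    ν.real (Ioi (quantile ν p)) ≤ 1 - p := by
  have h := (quantile_le_iff (ν := ν) hp0 hp1).1 le_rfl
  rw [← compl_Iic, probReal_compl_eq_one_sub measurableSet_Iic]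
  linarith

theorem measureReal_Iio_quantile_le (hp0 : 0 < p) (hp1 : p < 1) :
    ν.real (Iio (quantile ν p)) ≤ p := by
  obtain ⟨u, hu, hlt, hlim⟩ := exists_seq_strictMono_tendsto (quantile ν p)
  have hU : Iio (quantile ν p) = ⋃ k, Iic (u k) := by
    ext z
    simp only [mem_Iio, mem_iUnion, mem_Iic]
    refine ⟨fun hz => ?_, fun ⟨k, hk⟩ => hk.trans_lt (hlt k)⟩
    obtain ⟨k, hk⟩ := (hlim.eventually (eventually_gt_nhds hz)).exists
    exact ⟨k, hk.le⟩
  have hmono : Monotone fun k => Iic (u k) := fun a b hab => Iic_subset_Iic.2 (hu.monotone hab)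
  have ht := tendsto_measure_iUnion_atTop (μ := ν) hmono
  rw [← hU] at ht
  have ht' := (ENNReal.tendsto_toReal (measure_ne_top ν _)).comp ht
  refine le_of_tendsto ht' (Eventually.of_forall fun k => ?_)
  have : ¬ p ≤ ν.real (Iic (u k)) := fun h =>
    absurd ((quantile_le_iff hp0 hp1).2 h) (not_le.2 (hlt k))
  exact (not_le.1 this).le

end Quantile

/-! ### A tail bound for the normal distribution -/

/-- For `z > μ + r` one has `(z - μ)² ≥ (z - μ - r)² + r²`, which compares the density with the one
centred at `μ + r`. The half-line mass is kept as a factor so that the two tails together cost `exp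
(-c²/2)` and not twice that. -/
theorem gaussianReal_Ioi_add_le (μ : ℝ) {v : NNReal} (hv : v ≠ 0) {r : ℝ} (hr : 0 ≤ r) :
    gaussianReal μ v (Ioi (μ + r)) ≤
      ENNReal.ofReal (Real.exp (-(r ^ 2 / (2 * v)))) * gaussianReal 0 v (Ioi 0) := by
  have hshift : gaussianReal 0 v (Ioi 0) = gaussianReal (μ + r) v (Ioi (μ + r)) := by
    have h := gaussianReal_map_add_const (μ := 0) (v := v) (μ + r)
    rw [zero_add] at h
    rw [← h, Measure.map_apply (by fun_prop) measurableSet_Ioi]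
    congr 1
    ext z
    simp
  have hv' : (0 : ℝ) < v := by positivity
  rw [hshift, gaussianReal_apply _ hv, gaussianReal_apply _ hv,
    ← lintegral_const_mul _ (measurable_gaussianPDF _ _)]
  refine setLIntegral_mono ((measurable_gaussianPDF _ _).const_mul _) fun z hz => ?_
  rw [gaussianPDF, gaussianPDF, ← ENNReal.ofReal_mul (Real.exp_nonneg _)]
  refine ENNReal.ofReal_le_ofReal ?_
  rw [gaussianPDFReal, gaussianPDFReal, mul_left_comm, ← Real.exp_add]
  refine mul_le_mul_of_nonneg_left (Real.exp_le_exp.2 ?_) (by positivity)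
  rw [← neg_div, ← add_div]
  refine div_le_div_of_nonneg_right ?_ (by positivity)
  have : 0 ≤ z - (μ + r) := sub_nonneg.2 (le_of_lt hz)
  nlinarith

theorem gaussianReal_lt_abs_sub_le (μ : ℝ) {v : NNReal} {c : ℝ} (hc : 0 ≤ c) :
    gaussianReal μ v {z | c * Real.sqrt v < |z - μ|} ≤
      ENNReal.ofReal (Real.exp (-(c ^ 2 / 2))) := by
  -- With zero variance the law is a Dirac mass at `μ`, which the strict inequality excludes.
  by_cases hv : v = 0
  · subst hv
    simp [gaussianReal_zero_var]
  have hv' : (0 : ℝ) < v := by positivity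
  have hr : 0 ≤ c * Real.sqrt v := by positivity
  have hexp : (c * Real.sqrt v) ^ 2 / (2 * v) = c ^ 2 / 2 := by
    rw [mul_pow, Real.sq_sqrt hv'.le]
    field_simp
  have hneg : gaussianReal μ v (Iio (μ - c * Real.sqrt v)) =
      gaussianReal (-μ) v (Ioi (-μ + c * Real.sqrt v)) := by
    rw [← gaussianReal_map_neg, Measure.map_apply (by fun_prop) measurableSet_Ioi]
    congr 1
    ext z
    simp only [mem_Iio, mem_preimage, mem_Ioi]
    constructor <;> intro h <;> linarith
  have hneg0 : gaussianReal 0 v (Ioi 0) = gaussianReal 0 v (Iio 0) := by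
    have h := gaussianReal_map_neg (μ := 0) (v := v)
    rw [neg_zero] at h
    nth_rewrite 1 [← h]
    rw [Measure.map_apply (by fun_prop) measurableSet_Ioi]
    congr 1
    ext z
    simp
  have hle : gaussianReal 0 v (Ioi 0) + gaussianReal 0 v (Iio 0) ≤ 1 := by
    rw [← measure_union (by
      rw [Set.disjoint_left]
      intro z hz hz'
      exact lt_asymm (mem_Ioi.1 hz) (mem_Iio.1 hz')) measurableSet_Iio]
    exact prob_le_one
  have h1 := gaussianReal_Ioi_add_le μ hv hr
  have h2 := gaussianReal_Ioi_add_le (-μ) hv hr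
  rw [← hneg] at h2
  rw [hneg0] at h2
  rw [hexp] at h1 h2
  calc gaussianReal μ v {z | c * Real.sqrt v < |z - μ|}
      ≤ gaussianReal μ v (Ioi (μ + c * Real.sqrt v) ∪ Iio (μ - c * Real.sqrt v)) := by
        refine measure_mono fun z hz => ?_
        rcases lt_abs.1 (show c * Real.sqrt v < |z - μ| from hz) with h | h
        · left
          simp only [mem_Ioi]
          linarith
        · right
          simp only [mem_Iio]
          linarith
    _ ≤ _ := measure_union_le _ _
    _ ≤ _ := add_le_add h1 h2
    _ = ENNReal.ofReal (Real.exp (-(c ^ 2 / 2))) *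
        (gaussianReal 0 v (Ioi 0) + gaussianReal 0 v (Iio 0)) := by ring
    _ ≤ ENNReal.ofReal (Real.exp (-(c ^ 2 / 2))) * 1 := by gcongr
    _ = _ := mul_one _

end CUQB

namespace CUQB

open Matrix

/-! ### Posterior covariances -/

section SchurComplement

theorem posDef_add_smul_one {ι : Type*} [DecidableEq ι] {G : Matrix ι ι ℝ} (hG : G.PosSemidef) {v : ℝ} (hv : 0 < v) :
    (G + v • (1 : Matrix ι ι ℝ)).PosDef :=
  Matrix.PosDef.posSemidef_add hG (Matrix.PosDef.one.smul hv)

variable {ι κ : Type*} [Fintype ι] [DecidableEq ι] [Fintype κ] [DecidableEq κ]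

/-- The Schur complement is the minimum of the associated quadratic function. -/
theorem sub_dotProduct_inv_mulVec_le {A : Matrix ι ι ℝ} (hA : A.PosDef) (k : ℝ) (c w : ι → ℝ) :
    k - c ⬝ᵥ A⁻¹ *ᵥ c ≤ k - 2 * (w ⬝ᵥ c) + w ⬝ᵥ A *ᵥ w := by
  have hdet : IsUnit A.det := hA.det_pos.ne'.isUnit
  have hAT : Aᵀ = A := by simpa using hA.isHermitian.eq
  have h := hA.posSemidef.dotProduct_mulVec_nonneg (w - A⁻¹ *ᵥ c)
  have hAc : A *ᵥ A⁻¹ *ᵥ c = c := by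
    rw [mulVec_mulVec, mul_nonsing_inv _ hdet, one_mulVec]
  have hsymm : (A⁻¹ *ᵥ c) ⬝ᵥ A *ᵥ w = w ⬝ᵥ c := by
    rw [dotProduct_mulVec, ← mulVec_transpose, hAT, hAc, dotProduct_comm]
  rw [star_trivial, mulVec_sub, hAc, sub_dotProduct, dotProduct_sub, dotProduct_sub, hsymm,
    dotProduct_comm (A⁻¹ *ᵥ c) c] at h
  linarith

/-- The minimum in `sub_dotProduct_inv_mulVec_le` is attained at `A⁻¹ c`. -/
theorem dotProduct_inv_mulVec_eq {A : Matrix ι ι ℝ} (hA : A.PosDef) (k : ℝ) (c : ι → ℝ) :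
    k - 2 * ((A⁻¹ *ᵥ c) ⬝ᵥ c) + (A⁻¹ *ᵥ c) ⬝ᵥ A *ᵥ (A⁻¹ *ᵥ c) = k - c ⬝ᵥ A⁻¹ *ᵥ c := by
  have hdet : IsUnit A.det := hA.det_pos.ne'.isUnit
  have hAc : A *ᵥ A⁻¹ *ᵥ c = c := by
    rw [mulVec_mulVec, mul_nonsing_inv _ hdet, one_mulVec]
  rw [hAc, dotProduct_comm (A⁻¹ *ᵥ c) c]
  ring

/-- Conditioning on more observations does not increase the variance. -/
theorem schur_le_schur_submatrix {A : Matrix ι ι ℝ} (hA : A.PosDef) (k : ℝ) (c : ι → ℝ)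
    {e : κ → ι} (he : Function.Injective e) :
    k - c ⬝ᵥ A⁻¹ *ᵥ c ≤ k - (c ∘ e) ⬝ᵥ (A.submatrix e e)⁻¹ *ᵥ (c ∘ e) := by
  have hB : (A.submatrix e e).PosDef := hA.submatrix he
  set w₀ := (A.submatrix e e)⁻¹ *ᵥ (c ∘ e) with hw₀
  -- The minimizer of the smaller problem, extended by zero, is a competitor in the larger one.
  let w : ι → ℝ := fun i => ∑ s, if e s = i then w₀ s else 0
  have hw (f : ι → ℝ) : w ⬝ᵥ f = w₀ ⬝ᵥ (f ∘ e) := by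
    simp only [w, dotProduct, Finset.sum_mul, Function.comp_apply]
    rw [Finset.sum_comm]
    simp [ite_mul]
  have h := sub_dotProduct_inv_mulVec_le hA k c w
  have hAw : (A *ᵥ w) ∘ e = A.submatrix e e *ᵥ w₀ := by
    ext s
    simp only [Function.comp_apply, mulVec]
    rw [dotProduct_comm, hw, dotProduct_comm]
    rfl
  rw [hw, hw, hAw, dotProduct_inv_mulVec_eq hB] at h
  exact h

end SchurComplement

namespace Model

variable {𝒳 : Type*} {n m t : ℕ} (M : Model 𝒳 n m)

theorem posSemidef_gram (hK : M.K₀.PosSemidef) (D : Data 𝒳 m t) : (M.gram D).PosSemidef :=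
  hK.submatrix fun p : Fin t × Fin m => ((D p.1).1, p.2)

theorem posDef_gram_add (hK : M.K₀.PosSemidef) (hσ : 0 < M.σ) (D : Data 𝒳 m t) :
    (M.gram D + M.σ ^ 2 • 1).PosDef :=
  posDef_add_smul_one (M.posSemidef_gram hK D) (by positivity)

theorem K₀_symm (hK : M.K₀.PosSemidef) (p q : 𝒳 × Fin m) : M.K₀ p q = M.K₀ q p := by
  simpa using hK.isHermitian.apply q p

/-- The posterior covariance is the Schur complement in the joint covariance of noisy observations
and `h x`, which is a submatrix of `K₀` plus noise on the observation block. -/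
theorem posSemidef_postCov (hK : M.K₀.PosSemidef) (hσ : 0 < M.σ) (D : Data 𝒳 m t) (x : 𝒳) :
    (M.postCov D x).PosSemidef := by
  have hA := M.posDef_gram_add hK hσ D
  have : Invertible (M.gram D + M.σ ^ 2 • 1) := hA.isUnit.invertible
  have h := hA.fromBlocks₁₁ (M.crossCov D x)
    (Matrix.of fun j k => M.K₀ (x, j) (x, k))
  rw [conjTranspose_eq_transpose_of_trivial] at h
  refine h.1 ?_
  have h1 := hK.submatrix (Sum.elim (fun p : Fin t × Fin m => ((D p.1).1, p.2)) fun j => (x, j))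
  have h2 : (Matrix.fromBlocks (M.σ ^ 2 • 1) 0 0 0 :
      Matrix ((Fin t × Fin m) ⊕ Fin m) ((Fin t × Fin m) ⊕ Fin m) ℝ).PosSemidef := by
    have : (Matrix.fromBlocks (M.σ ^ 2 • 1) 0 0 0 :
        Matrix ((Fin t × Fin m) ⊕ Fin m) ((Fin t × Fin m) ⊕ Fin m) ℝ) =
        Matrix.diagonal (Sum.elim (fun _ => M.σ ^ 2) fun _ => 0) := by
      rw [← Matrix.diagonal_zero, ← fromBlocks_diagonal, smul_one_eq_diagonal]
    rw [this]
    exact Matrix.PosSemidef.diagonal fun i => by rcases i with i | i <;> simp [sq_nonneg]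
  have heq : Matrix.fromBlocks (M.gram D + M.σ ^ 2 • 1) (M.crossCov D x) (M.crossCov D x)ᵀ
      (Matrix.of fun j k => M.K₀ (x, j) (x, k)) =
      M.K₀.submatrix (Sum.elim (fun p : Fin t × Fin m => ((D p.1).1, p.2)) fun j => (x, j))
        (Sum.elim (fun p : Fin t × Fin m => ((D p.1).1, p.2)) fun j => (x, j)) +
        Matrix.fromBlocks (M.σ ^ 2 • 1) 0 0 0 := by
    ext (p | j) (q | k)
    · simp [gram]
    · simp [crossCov]
    · simp [crossCov, M.K₀_symm hK (x, j)]
    · simp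
  rw [heq]
  exact h1.add h2

/-- Prior covariance matrix of the `j`-th output at the query points of `a`. -/
def outputGram (j : Fin m) {t : ℕ} (a : Fin t → 𝒳) : Matrix (Fin t) (Fin t) ℝ :=
  Matrix.of fun s s' => M.K₀ (a s, j) (a s', j)

/-- Posterior variance of the `j`-th output at `x` given observations of this output only. -/
noncomputable def outputVar (j : Fin m) {t : ℕ} (a : Fin t → 𝒳) (x : 𝒳) : ℝ :=
  M.K₀ (x, j) (x, j) - (fun s => M.K₀ (a s, j) (x, j)) ⬝ᵥ
    (M.outputGram j a + M.σ ^ 2 • 1)⁻¹ *ᵥ fun s => M.K₀ (a s, j) (x, j)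

theorem posDef_outputGram_add (hK : M.K₀.PosSemidef) (hσ : 0 < M.σ) (j : Fin m)
    (a : Fin t → 𝒳) : (M.outputGram j a + M.σ ^ 2 • 1).PosDef :=
  posDef_add_smul_one (hK.submatrix fun s => (a s, j)) (by positivity)

/-- Discarding the observations of the other outputs can only increase the variance. This decouples
the outputs even when `K₀` correlates them. -/
theorem postCov_diag_le_outputVar (hK : M.K₀.PosSemidef) (hσ : 0 < M.σ) (D : Data 𝒳 m t) (x : 𝒳)
    (j : Fin m) : M.postCov D x j j ≤ M.outputVar j (fun s => (D s).1) x := by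
  have hinj : Function.Injective fun s : Fin t => (s, j) := fun s s' h => congrArg Prod.fst h
  have h := schur_le_schur_submatrix (M.posDef_gram_add hK hσ D) (M.K₀ (x, j) (x, j))
    (fun p => M.crossCov D x p j) hinj
  have hsub : (M.gram D + M.σ ^ 2 • 1).submatrix (fun s : Fin t => (s, j)) (fun s => (s, j)) =
      M.outputGram j (fun s => (D s).1) + M.σ ^ 2 • 1 := by
    ext s s'
    simp [gram, outputGram, Matrix.one_apply]
  rw [hsub] at h
  refine Eq.trans_le ?_ h
  simp only [postCov, Matrix.sub_apply, Matrix.of_apply]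
  rw [Matrix.mul_assoc]
  rfl

/-- It dominates a diagonal entry of a posterior covariance. Observed values do not enter that
covariance, so zeros serve as placeholders. -/
theorem outputVar_nonneg (hK : M.K₀.PosSemidef) (hσ : 0 < M.σ) (j : Fin m) (a : Fin t → 𝒳)
    (x : 𝒳) : 0 ≤ M.outputVar j a x :=
  ((M.posSemidef_postCov hK hσ (fun s => (a s, fun _ => 0)) x).diag_nonneg (i := j)).trans
    (M.postCov_diag_le_outputVar hK hσ (fun s => (a s, fun _ => 0)) x j)

theorem outputVar_le (hK : M.K₀.PosSemidef) (hσ : 0 < M.σ) (j : Fin m) (a : Fin t → 𝒳)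
    (x : 𝒳) : M.outputVar j a x ≤ M.K₀ (x, j) (x, j) := by
  have h := sub_dotProduct_inv_mulVec_le (M.posDef_outputGram_add hK hσ j a) (M.K₀ (x, j) (x, j))
    (fun s => M.K₀ (a s, j) (x, j)) 0
  simpa [outputVar] using h

/-- Block determinant formula: the Schur complement of the first `t` observations is the predictive
variance of the next noisy one. -/
theorem det_outputGram_succ (hK : M.K₀.PosSemidef) (hσ : 0 < M.σ) (j : Fin m)
    (a : Fin (t + 1) → 𝒳) :
    (M.outputGram j a + M.σ ^ 2 • 1).det =
      (M.outputGram j (fun s : Fin t => a s.castSucc) + M.σ ^ 2 • 1).det *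
        (M.σ ^ 2 + M.outputVar j (fun s : Fin t => a s.castSucc) (a (Fin.last t))) := by
  set a' : Fin t → 𝒳 := fun s => a s.castSucc with ha'
  set x := a (Fin.last t) with hx
  have : Invertible (M.outputGram j a' + M.σ ^ 2 • 1) :=
    (M.posDef_outputGram_add hK hσ j a').isUnit.invertible
  have hblock : (M.outputGram j a + M.σ ^ 2 • 1).submatrix (finSumFinEquiv (m := t) (n := 1))
      finSumFinEquiv = Matrix.fromBlocks (M.outputGram j a' + M.σ ^ 2 • 1)
        (Matrix.of fun s _ => M.K₀ (a' s, j) (x, j)) (Matrix.of fun _ s => M.K₀ (a' s, j) (x, j))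
        (Matrix.of fun _ _ => M.K₀ (x, j) (x, j) + M.σ ^ 2) := by
    have hl : Fin.natAdd t (0 : Fin 1) = Fin.last t := rfl
    have hc (s : Fin t) : Fin.castAdd 1 s = s.castSucc := rfl
    have hne (s : Fin t) : s.castSucc ≠ Fin.last t := (Fin.castSucc_lt_last s).ne
    ext (s | s) (s' | s')
    · simp [outputGram, Matrix.one_apply, a', hc]
    · obtain rfl := Subsingleton.elim s' 0
      simp [outputGram, a', hl, hc, hne, x]
    · obtain rfl := Subsingleton.elim s 0
      simp [outputGram, a', hl, hc, (hne _).symm, x, M.K₀_symm hK (a (Fin.last t), j)]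
    · obtain rfl := Subsingleton.elim s 0
      obtain rfl := Subsingleton.elim s' 0
      simp [outputGram, hl, x]
  rw [← Matrix.det_submatrix_equiv_self (finSumFinEquiv (m := t) (n := 1)), hblock,
    Matrix.det_fromBlocks₁₁]
  congr 1
  rw [Matrix.det_unique, Matrix.invOf_eq_nonsing_inv, Matrix.mul_assoc]
  simp only [Matrix.sub_apply, Matrix.of_apply, outputVar]
  rw [add_comm, add_sub_assoc]
  rfl

/-- The chain rule for information gain, obtained by telescoping the determinants. -/
theorem log_det_outputGram (hK : M.K₀.PosSemidef) (hσ : 0 < M.σ) (j : Fin m) (a : ℕ → 𝒳) (t : ℕ) :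
    Real.log (1 + (M.σ ^ 2)⁻¹ • M.outputGram j (fun s : Fin t => a s)).det =
      ∑ s ∈ Finset.range t,
        Real.log (1 + M.outputVar j (fun s' : Fin s => a s') (a s) / M.σ ^ 2) := by
  have hσ2 : (0 : ℝ) < M.σ ^ 2 := by positivity
  have hdet (t : ℕ) : (1 + (M.σ ^ 2)⁻¹ • M.outputGram j (fun s : Fin t => a s)).det =
      ((M.σ ^ 2)⁻¹) ^ t * (M.outputGram j (fun s : Fin t => a s) + M.σ ^ 2 • 1).det := by
    have : (1 + (M.σ ^ 2)⁻¹ • M.outputGram j (fun s : Fin t => a s)) =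
        (M.σ ^ 2)⁻¹ • (M.outputGram j (fun s : Fin t => a s) + M.σ ^ 2 • 1) := by
      rw [smul_add, smul_smul, inv_mul_cancel₀ hσ2.ne', one_smul, add_comm]
    rw [this, Matrix.det_smul, Fintype.card_fin]
  have hpos (t : ℕ) : 0 < (1 + (M.σ ^ 2)⁻¹ • M.outputGram j (fun s : Fin t => a s)).det := by
    rw [hdet]
    have := (M.posDef_outputGram_add hK hσ j (fun s : Fin t => a s)).det_pos
    positivity
  induction t with
  | zero => simp
  | succ t ih =>
    have hvar := M.outputVar_nonneg hK hσ j (fun s' : Fin t => a s') (a t)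
    rw [Finset.sum_range_succ, ← ih, ← Real.log_mul (hpos t).ne' (by positivity), hdet, hdet,
      M.det_outputGram_succ hK hσ j]
    congr 1
    simp only [Fin.val_castSucc, Fin.val_last, pow_succ]
    field_simp

end Model

end CUQB

/-! ### Sums of posterior standard deviations and information gain -/

namespace CUQB

open Matrix Set Filter Topology

/-- From `log (1 + y) ≥ y / (1 + y)` at `y = s / v`, together with `v + s ≤ 2 w`. It is applied with
`v = σ²` and `w = 1 + 2/T`, which is where the noise bound enters. -/
theorem le_mul_log_one_add_div {s v w : ℝ} (hs : 0 ≤ s) (hs1 : s ≤ 1) (hv : 0 < v) (hvw : v ≤ w)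
    (hw : 1 ≤ w) : s ≤ 2 * w * Real.log (1 + s / v) := by
  have hpos : 0 < 1 + s / v := by positivity
  have h := Real.one_sub_inv_le_log_of_pos hpos
  have h1 : 1 - (1 + s / v)⁻¹ = s / (v + s) := by
    have : v + s ≠ 0 := by positivity
    field_simp
    ring
  rw [h1] at h
  have h2 : s / (2 * w) ≤ s / (v + s) :=
    div_le_div_of_nonneg_left hs (by positivity) (by linarith)
  have h3 := h2.trans h
  rwa [div_le_iff₀ (by positivity), mul_comm] at h3

namespace Model

variable {𝒳 : Type*} {n m t : ℕ} (M : Model 𝒳 n m)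

theorem half_log_det_le_infoGain [Finite 𝒳] (j : Fin m) {T : ℕ} (a : Fin T → 𝒳) :
    1 / 2 * Real.log (1 + (M.σ ^ 2)⁻¹ • M.outputGram j a).det ≤ M.infoGain j T :=
  le_ciSup (f := fun a : Fin T → 𝒳 => (1 / 2 : ℝ) * Real.log
    (1 + (M.σ ^ 2)⁻¹ • M.outputGram j a).det) (Set.finite_range _).bddAbove a

theorem sum_sqrt_outputVar_le [Finite 𝒳] (hK : M.K₀.PosSemidef)
    (hK_le : ∀ (x : 𝒳) (j : Fin m), M.K₀ (x, j) (x, j) ≤ 1) {T : ℕ} (hT : 1 ≤ T) (hσ : 0 < M.σ)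
    (hσ_le : M.σ ^ 2 ≤ 1 + 2 / (T : ℝ)) (j : Fin m) (a : ℕ → 𝒳) :
    ∑ t ∈ Finset.range T, Real.sqrt (M.outputVar j (fun s : Fin t => a s) (a t)) ≤
      2 * Real.sqrt (((T : ℝ) + 2) * M.infoGain j T) := by
  have hT0 : (0 : ℝ) < T := by exact_mod_cast hT
  have hnn (t : ℕ) := M.outputVar_nonneg hK hσ j (fun s : Fin t => a s) (a t)
  have hvar : ∑ t ∈ Finset.range T, M.outputVar j (fun s : Fin t => a s) (a t) ≤
      4 * (1 + 2 / (T : ℝ)) * M.infoGain j T := by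
    have hlog := M.log_det_outputGram hK hσ j a T
    have hgain := M.half_log_det_le_infoGain j (fun s : Fin T => a s)
    rw [hlog] at hgain
    calc ∑ t ∈ Finset.range T, M.outputVar j (fun s : Fin t => a s) (a t)
        ≤ ∑ t ∈ Finset.range T, 2 * (1 + 2 / (T : ℝ)) *
          Real.log (1 + M.outputVar j (fun s : Fin t => a s) (a t) / M.σ ^ 2) :=
          Finset.sum_le_sum fun t _ => le_mul_log_one_add_div (hnn t)
            ((M.outputVar_le hK hσ j _ _).trans (hK_le _ _)) (by positivity) hσ_le
            (by linarith [show 0 ≤ 2 / (T : ℝ) by positivity])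
      _ = 4 * (1 + 2 / (T : ℝ)) * (1 / 2 * ∑ t ∈ Finset.range T,
          Real.log (1 + M.outputVar j (fun s : Fin t => a s) (a t) / M.σ ^ 2)) := by
          rw [← Finset.mul_sum]
          ring
      _ ≤ _ := mul_le_mul_of_nonneg_left hgain (by positivity)
  -- Cauchy–Schwarz contributes the factor `T`, and `T * 4 (1 + 2/T) = 4 (T + 2)`.
  have hcs := sq_sum_le_card_mul_sum_sq (s := Finset.range T)
    (f := fun t => Real.sqrt (M.outputVar j (fun s : Fin t => a s) (a t)))
  simp only [Finset.card_range, Real.sq_sqrt (hnn _)] at hcs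
  rw [show (2 : ℝ) = Real.sqrt 4 by rw [show (4 : ℝ) = 2 ^ 2 by norm_num]; simp,
    ← Real.sqrt_mul (by norm_num)]
  refine Real.le_sqrt_of_sq_le (hcs.trans ?_)
  calc (T : ℝ) * ∑ t ∈ Finset.range T, M.outputVar j (fun s : Fin t => a s) (a t)
      ≤ T * (4 * (1 + 2 / (T : ℝ)) * M.infoGain j T) := mul_le_mul_of_nonneg_left hvar hT0.le
    _ = _ := by
      rw [show Real.sqrt 4 = 2 by rw [show (4 : ℝ) = 2 ^ 2 by norm_num]; simp]
      field_simp

end Model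

/-! ### Widths of the confidence intervals -/

theorem continuous_of_abs_sub_le {m : ℕ} {g : (Fin m → ℝ) → ℝ} {L : ℝ}
    (hg : ∀ y z, |g y - g z| ≤ L * ∑ j, |y j - z j|) : Continuous g := by
  refine continuous_iff_continuousAt.2 fun z => ?_
  refine tendsto_iff_dist_tendsto_zero.2 (squeeze_zero (fun _ => dist_nonneg)
    (fun y => (Real.dist_eq (g y) (g z)).trans_le (hg y z)) ?_)
  have : Continuous fun y : Fin m → ℝ => L * ∑ j, |y j - z j| := by fun_prop
  simpa using this.tendsto z

theorem lipschitz_const_nonneg {m : ℕ} (hm : 0 < m) {g : (Fin m → ℝ) → ℝ} {L : ℝ}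
    (hg : ∀ y z, |g y - g z| ≤ L * ∑ j, |y j - z j|) : 0 ≤ L := by
  have h := (abs_nonneg _).trans (hg 1 0)
  simp only [Pi.one_apply, Pi.zero_apply, sub_zero, abs_one, Finset.sum_const, Finset.card_univ,
    Fintype.card_fin, nsmul_eq_mul, mul_one] at h
  have : (0 : ℝ) < m := by exact_mod_cast hm
  nlinarith

theorem multivariateGaussian_exists_lt_abs_sub_le {ι : Type*} [Fintype ι] [DecidableEq ι]
    (μ : EuclideanSpace ℝ ι) {S : Matrix ι ι ℝ} (hS : S.PosSemidef) {c : ℝ} (hc : 0 ≤ c) :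
    (multivariateGaussian μ S).real {z | ∃ j, c * Real.sqrt (S j j) < |z j - μ j|} ≤
      Fintype.card ι * Real.exp (-(c ^ 2 / 2)) := by
  have h1 (j : ι) : (multivariateGaussian μ S) {z | c * Real.sqrt (S j j) < |z j - μ j|} ≤
      ENNReal.ofReal (Real.exp (-(c ^ 2 / 2))) := by
    have hmp := measurePreserving_eval_multivariateGaussian (μ := μ) hS (i := j)
    have hms : MeasurableSet {y : ℝ | c * Real.sqrt (S j j) < |y - μ j|} :=
      measurableSet_lt measurable_const (by fun_prop)
    have := gaussianReal_lt_abs_sub_le (μ j) (v := (S j j).toNNReal) hc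
    rw [Real.coe_toNNReal _ hS.diag_nonneg, ← hmp.measure_preimage hms.nullMeasurableSet] at this
    exact this
  rw [Measure.real]
  refine ENNReal.toReal_le_of_le_ofReal (by positivity) ?_
  rw [ofPred_exists]
  refine (measure_iUnion_fintype_le _ _).trans ((Finset.sum_le_sum fun j _ => h1 j).trans ?_)
  rw [Finset.sum_const, Finset.card_univ, nsmul_eq_mul, ENNReal.ofReal_mul (by positivity),
    ENNReal.ofReal_natCast]

namespace Model

variable {𝒳 : Type*} {n m t : ℕ} (M : Model 𝒳 n m)

theorem isProbabilityMeasure_predLaw {i : Fin (n + 1)} {x : 𝒳} (hg : Continuous (M.g i x))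
    (D : Data 𝒳 m t) : IsProbabilityMeasure (M.predLaw D i x) :=
  Measure.isProbabilityMeasure_map
    (hg.measurable.comp (by fun_prop : Measurable fun z : EuclideanSpace ℝ (Fin m) =>
      z.ofLp)).aemeasurable

theorem predLaw_real_apply {i : Fin (n + 1)} {x : 𝒳} (hg : Continuous (M.g i x))
    (D : Data 𝒳 m t) {s : Set ℝ} (hs : MeasurableSet s) :
    (M.predLaw D i x).real s = (multivariateGaussian (WithLp.toLp 2 (M.postMean D x))
      (M.postCov D x)).real {z | M.g i x z.ofLp ∈ s} :=
  map_measureReal_apply (hg.measurable.comp (by fun_prop)) hs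

variable [Fintype 𝒳]

theorem level_pos [Nonempty 𝒳] {δ : ℝ} (hδ : 0 < δ) (t : ℕ) : 0 < M.level δ t := by
  rw [level]
  have : (0 : ℝ) < Fintype.card 𝒳 := by exact_mod_cast Fintype.card_pos
  positivity

theorem level_lt_one [Nonempty 𝒳] {δ : ℝ} (hδ : 0 < δ) (hδ1 : δ < 1) (t : ℕ) :
    M.level δ t < 1 := by
  have hX : (1 : ℝ) ≤ Fintype.card 𝒳 := by exact_mod_cast Fintype.card_pos
  have hpi : (9 : ℝ) ≤ Real.pi ^ 2 := by nlinarith [Real.pi_gt_three]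
  have ht : (1 : ℝ) ≤ ((t : ℝ) + 1) ^ 2 := by
    have : (0 : ℝ) ≤ t := by positivity
    nlinarith
  have hn : (1 : ℝ) ≤ (n : ℝ) + 1 := by
    have : (0 : ℝ) ≤ n := by positivity
    linarith
  rw [level, div_lt_one (by positivity)]
  calc 6 * δ < 9 * 1 * 1 * 1 := by linarith
    _ ≤ _ := by gcongr

/-- `β_T` is chosen so that equality holds at `t = T - 1`; the levels decrease in `t`. -/
theorem mul_exp_neg_beta_le [Nonempty 𝒳] (hm : 0 < m) {δ : ℝ} (hδ : 0 < δ) {t T : ℕ}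
    (ht : t < T) : m * Real.exp (-(M.beta δ T / 2)) ≤ M.level δ t / 2 := by
  have hX : (0 : ℝ) < Fintype.card 𝒳 := by exact_mod_cast Fintype.card_pos
  have hT : (0 : ℝ) < T := by exact_mod_cast (Nat.zero_le t).trans_lt ht
  have hm' : (0 : ℝ) < m := by exact_mod_cast hm
  have htT : (t : ℝ) + 1 ≤ T := by exact_mod_cast ht
  rw [beta, level, mul_div_cancel_left₀ _ two_ne_zero, Real.exp_neg, Real.exp_log (by positivity)]
  calc (m : ℝ) * (m * Real.pi ^ 2 * (T : ℝ) ^ 2 * ((n : ℝ) + 1) * Fintype.card 𝒳 / (3 * δ))⁻¹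
      = 6 * δ / (Real.pi ^ 2 * (T : ℝ) ^ 2 * ((n : ℝ) + 1) * Fintype.card 𝒳) / 2 := by
        field_simp
        ring
    _ ≤ _ := by gcongr

theorem beta_pos [Nonempty 𝒳] (hm : 0 < m) {δ : ℝ} (hδ : 0 < δ) (hδ1 : δ < 1) {T : ℕ}
    (hT : 1 ≤ T) : 0 < M.beta δ T := by
  have hX : (1 : ℝ) ≤ Fintype.card 𝒳 := by exact_mod_cast Fintype.card_pos
  have hT' : (1 : ℝ) ≤ T := by exact_mod_cast hT
  have hm' : (1 : ℝ) ≤ m := by exact_mod_cast hm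
  have hn : (1 : ℝ) ≤ (n : ℝ) + 1 := by
    have : (0 : ℝ) ≤ n := by positivity
    linarith
  have hpi : (9 : ℝ) ≤ Real.pi ^ 2 := by nlinarith [Real.pi_gt_three]
  refine mul_pos two_pos (Real.log_pos ?_)
  rw [one_lt_div (by positivity)]
  calc 3 * δ < 1 * 9 * 1 ^ 2 * 1 * 1 := by linarith
    _ ≤ _ := by gcongr

theorem upper_sub_lower_le [Nonempty 𝒳] (hm : 0 < m) (hK : M.K₀.PosSemidef) (hσ : 0 < M.σ)
    {i : Fin (n + 1)} {x : 𝒳} {L : ℝ}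
    (hg : ∀ y z, |M.g i x y - M.g i x z| ≤ L * ∑ j, |y j - z j|)
    {δ : ℝ} (hδ : 0 < δ) (hδ1 : δ < 1) {T : ℕ} (ht : t < T) (D : Data 𝒳 m t) :
    M.upper δ D i x - M.lower δ D i x ≤
      2 * L * Real.sqrt (M.beta δ T) * ∑ j, Real.sqrt (M.postCov D x j j) := by
  have hS := M.posSemidef_postCov hK hσ D x
  have hL := lipschitz_const_nonneg hm hg
  have hgc := continuous_of_abs_sub_le hg
  have := M.isProbabilityMeasure_predLaw hgc D
  have hα := M.level_pos hδ t
  have hα1 := M.level_lt_one hδ hδ1 t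
  have hβ := M.beta_pos hm hδ hδ1 (T := T) (by omega)
  set S := ∑ j, Real.sqrt (M.postCov D x j j) with hSdef
  set μ := M.postMean D x with hμ
  -- Taking `c` strictly above `√β_T` makes the tail strictly smaller than `α_t / 2`, as the lower
  -- quantile requires; `c` then decreases to `√β_T`.
  have key (c : ℝ) (hc : Real.sqrt (M.beta δ T) < c) :
      M.upper δ D i x - M.lower δ D i x ≤ 2 * L * c * S := by
    have hc0 : 0 ≤ c := (Real.sqrt_nonneg _).trans hc.le
    have htail := multivariateGaussian_exists_lt_abs_sub_le (WithLp.toLp 2 μ) hS hc0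
    have hexp : (m : ℝ) * Real.exp (-(c ^ 2 / 2)) < M.level δ t / 2 := by
      refine lt_of_lt_of_le ?_ (M.mul_exp_neg_beta_le hm hδ ht)
      have : M.beta δ T < c ^ 2 := (Real.sqrt_lt' (by
        exact (Real.sqrt_nonneg _).trans_lt hc)).1 hc
      have hm' : (0 : ℝ) < m := by exact_mod_cast hm
      gcongr
    rw [Fintype.card_fin] at htail
    have hbad := htail.trans_lt hexp
    have hgood (z : EuclideanSpace ℝ (Fin m))
        (hz : ¬ ∃ j, c * Real.sqrt (M.postCov D x j j) < |z j - μ j|) :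
        |M.g i x z.ofLp - M.g i x μ| ≤ L * c * S := by
      push Not at hz
      refine (hg _ _).trans ?_
      rw [mul_assoc, hSdef, Finset.mul_sum Finset.univ _ c]
      exact mul_le_mul_of_nonneg_left (Finset.sum_le_sum fun j _ => hz j) hL
    have hup : M.upper δ D i x ≤ M.g i x μ + L * c * S := by
      rw [upper, quantile_le_iff (by linarith) (by linarith),
        ← compl_Ioi, probReal_compl_eq_one_sub measurableSet_Ioi,
        predLaw_real_apply M hgc D measurableSet_Ioi]
      refine sub_le_sub_left ((measureReal_mono fun z hz => ?_).trans hbad.le) 1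
      by_contra hcon
      have := (abs_le.1 (hgood z hcon)).2
      have hz' : M.g i x μ + L * c * S < M.g i x z.ofLp := hz
      linarith
    have hlow : M.g i x μ - L * c * S ≤ M.lower δ D i x := by
      refine le_of_forall_lt fun y hy => ?_
      rw [lower, ← not_le, quantile_le_iff (by linarith) (by linarith), not_le,
        predLaw_real_apply M hgc D measurableSet_Iic]
      refine (measureReal_mono fun z hz => ?_).trans_lt hbad
      by_contra hcon
      have := (abs_le.1 (hgood z hcon)).1
      have hz' : M.g i x z.ofLp ≤ y := hz
      linarith
    linarith
  have hcont : Continuous fun c : ℝ => 2 * L * c * S := by fun_prop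
  have hlim : Tendsto (fun c : ℝ => 2 * L * c * S) (𝓝[>] Real.sqrt (M.beta δ T))
      (𝓝 (2 * L * Real.sqrt (M.beta δ T) * S)) :=
    (hcont.tendsto _).mono_left nhdsWithin_le_nhds
  refine ge_of_tendsto hlim ?_
  filter_upwards [self_mem_nhdsWithin] with c hc using key c hc

end Model

end CUQB

namespace CUQB

/-! ### Gaussian regression -/

section Regression

open Matrix

variable {Ω : Type*} [MeasurableSpace Ω] {P : Measure Ω} {ι κ : Type*}
  [Fintype ι] [Fintype κ] [DecidableEq κ]

theorem hasLaw_multivariateGaussian_of_covariance [IsProbabilityMeasure P] {R : κ → Ω → ℝ}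
    (hR : HasGaussianLaw (fun ω j => R j ω) P) {S : Matrix κ κ ℝ} (hS : S.PosSemidef)
    (hmean : ∀ j, ∫ ω, R j ω ∂P = 0) (hcov : ∀ j k, cov[R j, R k; P] = S j k) :
    HasLaw (fun ω => WithLp.toLp 2 fun j => R j ω) (multivariateGaussian 0 S) P := by
  have hL := hR.toLp_pi 2
  have hm (j : κ) : MemLp (R j) 2 P := (hR.eval j).memLp_two
  refine ⟨hL.aemeasurable, ?_⟩
  have := hL.isGaussian_map
  refine IsGaussian.ext ?_ ?_
  · rw [integral_id_multivariateGaussian', integral_map hL.aemeasurable (by fun_prop)]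
    ext j
    have h : ∫ ω, R j ω ∂P = _ :=
      (EuclideanSpace.proj j : EuclideanSpace ℝ κ →L[ℝ] ℝ).integral_comp_comm hL.integrable
    refine h.symm.trans ?_
    rw [hmean]
    rfl
  · rw [← ContinuousLinearMap.toBilinForm_inj]
    refine LinearMap.BilinForm.ext_basis (EuclideanSpace.basisFun κ ℝ).toBasis fun i j => ?_
    rw [ContinuousLinearMap.toBilinForm_apply, ContinuousLinearMap.toBilinForm_apply,
      covarianceBilin_multivariateGaussian hS]
    simp only [OrthonormalBasis.coe_toBasis]
    rw [covarianceBilin_apply_basisFun hm, hcov]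
    simp

variable [DecidableEq ι] {U : κ → Ω → ℝ} {Y : ι → Ω → ℝ}

/-- The weights `W = Cᵀ A⁻¹` satisfy `W A = Cᵀ`, so `U - W Y` is uncorrelated with `Y`; joint
Gaussianity turns this into independence. Its covariance with itself equals that with `U`, namely `B
- W C`. -/
theorem regression_residual [IsProbabilityMeasure P]
    (hUY : HasGaussianLaw (fun ω => (fun j => U j ω, fun p => Y p ω)) P)
    {A : Matrix ι ι ℝ} (hA : IsUnit A.det) {B : Matrix κ κ ℝ} {C : Matrix ι κ ℝ}
    (hYY : ∀ p q, cov[Y p, Y q; P] = A p q) (hYU : ∀ p j, cov[Y p, U j; P] = C p j)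
    (hUU : ∀ j k, cov[U j, U k; P] = B j k) (hS : (B - Cᵀ * A⁻¹ * C).PosSemidef)
    {u : κ → ℝ} {y : ι → ℝ} (hu : ∀ j, ∫ ω, U j ω ∂P = u j) (hy : ∀ p, ∫ ω, Y p ω ∂P = y p) :
    IndepFun (fun ω j => U j ω - (u j + ((Cᵀ * A⁻¹) *ᵥ fun p => Y p ω - y p) j))
      (fun ω p => Y p ω) P ∧
    HasLaw (fun ω => WithLp.toLp 2 fun j =>
      U j ω - (u j + ((Cᵀ * A⁻¹) *ᵥ fun p => Y p ω - y p) j))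
      (multivariateGaussian 0 (B - Cᵀ * A⁻¹ * C)) P := by
  set W := Cᵀ * A⁻¹ with hW
  have hWA : W * A = Cᵀ := by rw [hW, Matrix.mul_assoc, nonsing_inv_mul _ hA, Matrix.mul_one]
  have hmU (j : κ) : MemLp (U j) 2 P := (hUY.fst.eval j).memLp_two
  have hmY (p : ι) : MemLp (Y p) 2 P := (hUY.snd.eval p).memLp_two
  let R₀ : κ → Ω → ℝ := fun j ω => U j ω - ∑ p, W j p * Y p ω
  let c : κ → ℝ := fun j => u j - ∑ p, W j p * y p
  have hmS (j : κ) : MemLp (fun ω => ∑ p, W j p * Y p ω) 2 P :=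
    memLp_finsetSum _ fun p _ => (hmY p).const_mul _
  have hmR (j : κ) : MemLp (R₀ j) 2 P := (hmU j).sub (hmS j)
  have hR (j : κ) (ω : Ω) :
      U j ω - (u j + (W *ᵥ fun p => Y p ω - y p) j) = R₀ j ω - c j := by
    simp only [R₀, c, mulVec, dotProduct, mul_sub, Finset.sum_sub_distrib]
    ring
  have hRY (j : κ) (q : ι) : cov[R₀ j, Y q; P] = 0 := by
    have h1 : cov[fun ω => ∑ p, W j p * Y p ω, Y q; P] = C q j := by
      rw [covariance_fun_sum_left (fun p => (hmY p).const_mul _) (hmY q)]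
      simp_rw [covariance_const_mul_left, hYY]
      rw [← Matrix.mul_apply, hWA, transpose_apply]
    rw [covariance_fun_sub_left (hmU j) (hmS j) (hmY q), h1, covariance_comm, hYU, sub_self]
  have hRU (j k : κ) : cov[R₀ j, U k; P] = (B - W * C) j k := by
    rw [covariance_fun_sub_left (hmU j) (hmS j) (hmU k), hUU,
      covariance_fun_sum_left (fun p => (hmY p).const_mul _) (hmU k)]
    simp_rw [covariance_const_mul_left, hYU]
    rw [← Matrix.mul_apply, Matrix.sub_apply]
  have hRR (j k : κ) : cov[R₀ j, R₀ k; P] = (B - W * C) j k := by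
    rw [covariance_fun_sub_right (hmR j) (hmU k) (hmS k), hRU,
      covariance_fun_sum_right (fun p => (hmY p).const_mul _) (hmR j)]
    simp_rw [covariance_const_mul_right, hRY]
    simp
  have hlaw : HasGaussianLaw (fun ω => (fun j => R₀ j ω, fun p => Y p ω)) P := by
    let Λ : (κ → ℝ) × (ι → ℝ) →L[ℝ] (κ → ℝ) × (ι → ℝ) :=
      (ContinuousLinearMap.fst ℝ _ _ - (Matrix.mulVecLin W).toContinuousLinearMap.comp
        (ContinuousLinearMap.snd ℝ _ _)).prod (ContinuousLinearMap.snd ℝ _ _)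
    exact hUY.map_fun Λ
  have hind := hlaw.indepFun_of_covariance_eval hRY
  simp_rw [hR]
  refine ⟨hind.comp (φ := fun (r : κ → ℝ) j => r j - c j) (ψ := id) (by fun_prop) measurable_id, ?_⟩
  refine hasLaw_multivariateGaussian_of_covariance (R := fun j ω => R₀ j ω - c j) ?_ hS ?_ ?_
  · have hg := hlaw.fst
    refine ⟨?_⟩
    have := hg.isGaussian_map
    have hmap : P.map (fun ω j => R₀ j ω - c j) =
        (P.map fun ω j => R₀ j ω).map fun r => r - c := by
      rw [AEMeasurable.map_map_of_aemeasurable (by fun_prop) hg.aemeasurable]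
      rfl
    rw [hmap]
    infer_instance
  · intro j
    have hi (p : ι) : Integrable (fun ω => W j p * Y p ω) P :=
      ((hmY p).integrable one_le_two).const_mul _
    rw [integral_sub ((hmR j).integrable one_le_two) (integrable_const _),
      integral_sub ((hmU j).integrable one_le_two) ((hmS j).integrable one_le_two),
      integral_finsetSum _ fun p _ => hi p]
    simp_rw [integral_const_mul, hu, hy]
    simp [c]
  · intro j k
    rw [covariance_sub_const_left ((hmR j).integrable one_le_two),
      covariance_sub_const_right ((hmR k).integrable one_le_two), hRR]

end Regression

end CUQB

/-! ### The posterior at a fixed design -/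

namespace CUQB

namespace Model

open Matrix

theorem integral_eval_of_hasLaw {Ω : Type*} [MeasurableSpace Ω] {P : Measure Ω} {ι : Type*}
    [Fintype ι] [DecidableEq ι] {X : Ω → EuclideanSpace ℝ ι}
    {μ : EuclideanSpace ℝ ι} {S : Matrix ι ι ℝ} (hX : HasLaw X (multivariateGaussian μ S) P)
    (i : ι) : ∫ ω, X ω i ∂P = μ i := by
  have h : ∫ ω, X ω i ∂P = (∫ ω, X ω ∂P) i :=
    (EuclideanSpace.proj i : EuclideanSpace ℝ ι →L[ℝ] ℝ).integral_comp_comm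
      hX.hasGaussianLaw.integrable
  rw [h, hX.integral_eq, integral_id_multivariateGaussian]

variable {𝒳 : Type*} {n m t : ℕ} (M : Model 𝒳 n m)
  {Ω : Type*} [MeasurableSpace Ω] {P : Measure Ω}
  {h : Ω → 𝒳 → Fin m → ℝ} {ε : ℕ → Ω → Fin m → ℝ}

theorem covariance_noise (hε : M.IsNoise P ε)
    (s s' : ℕ) (j k : Fin m) :
    cov[fun ω => ε s ω j, fun ω => ε s' ω k; P] = if s = s' ∧ j = k then M.σ ^ 2 else 0 := by
  have hmem (s : ℕ) (j : Fin m) : MemLp (fun ω => ε s ω j) 2 P :=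
    ((hε.2 s).hasGaussianLaw.map_fun
      (EuclideanSpace.proj j : EuclideanSpace ℝ (Fin m) →L[ℝ] ℝ)).memLp_two
  by_cases hs : s = s'
  · subst hs
    have hS : (M.σ ^ 2 • 1 : Matrix (Fin m) (Fin m) ℝ).PosSemidef :=
      Matrix.PosSemidef.one.smul (sq_nonneg _)
    have h1 := covariance_eval_multivariateGaussian (μ := 0) hS j k
    rw [← (hε.2 s).covariance_fun_comp (by fun_prop) (by fun_prop)] at h1
    simpa [Matrix.one_apply] using h1
  · have hi : IndepFun (fun ω => ε s ω j) (fun ω => ε s' ω k) P :=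
      (hε.1.indepFun hs).comp (φ := fun z : Fin m → ℝ => z j) (ψ := fun z : Fin m → ℝ => z k)
        (by fun_prop) (by fun_prop)
    rw [hi.covariance_eq_zero (hmem _ _) (hmem _ _)]
    simp [hs]

variable [Fintype 𝒳]

theorem hasGaussianLaw_prior_noise (hh : M.IsGPSample P h) (hε : M.IsNoise P ε)
    (h_indep : IndepFun h (fun ω t => ε t ω) P) (t : ℕ) :
    HasGaussianLaw (fun ω => (WithLp.toLp 2 (fun p : 𝒳 × Fin m => h ω p.1 p.2),
      fun s : Fin t => WithLp.toLp 2 (ε s ω))) P := by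
  classical
  have hH := hh.hasGaussianLaw
  have hN : HasGaussianLaw (fun ω => fun s : Fin t => WithLp.toLp 2 (ε s ω)) P := by
    refine iIndepFun.hasGaussianLaw (fun s => (hε.2 s).hasGaussianLaw) ?_
    exact (hε.1.precomp Fin.val_injective).comp (fun _ z => WithLp.toLp 2 z) fun _ => by fun_prop
  refine IndepFun.hasGaussianLaw hH hN ?_
  exact h_indep.comp
    (φ := fun h : 𝒳 → Fin m → ℝ => WithLp.toLp 2 (fun p : 𝒳 × Fin m => h p.1 p.2))
    (ψ := fun (e : ℕ → Fin m → ℝ) (s : Fin t) => WithLp.toLp 2 (e s)) (by fun_prop) (by fun_prop)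

theorem covariance_prior (hK : M.K₀.PosSemidef) (hh : M.IsGPSample P h) (p q : 𝒳 × Fin m) :
    cov[fun ω => h ω p.1 p.2, fun ω => h ω q.1 q.2; P] = M.K₀ p q := by
  classical
  have h1 := covariance_eval_multivariateGaussian
    (μ := WithLp.toLp 2 (fun p : 𝒳 × Fin m => M.μ₀ p.1 p.2)) hK p q
  rw [← hh.covariance_fun_comp (by fun_prop) (by fun_prop)] at h1
  exact h1

/-- The observations made at the fixed design `a`. -/
def observations (h : Ω → 𝒳 → Fin m → ℝ) (ε : ℕ → Ω → Fin m → ℝ) (a : Fin t → 𝒳) (ω : Ω) :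
    Fin t → Fin m → ℝ :=
  fun s j => h ω (a s) j + ε s ω j

/-- The data consisting of the design `a` and the observations `y`. -/
def designData (a : Fin t → 𝒳) (y : Fin t → Fin m → ℝ) : Data 𝒳 m t :=
  fun s => (a s, y s)

theorem posterior_residual [IsProbabilityMeasure P] (hK : M.K₀.PosSemidef) (hσ : 0 < M.σ)
    (hh : M.IsGPSample P h) (hε : M.IsNoise P ε)
    (h_indep : IndepFun h (fun ω t => ε t ω) P) (a : Fin t → 𝒳) (x : 𝒳) :
    IndepFun (fun ω j => h ω x j - M.postMean (designData a (observations h ε a ω)) x j)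
      (observations h ε a) P ∧
    HasLaw (fun ω => WithLp.toLp 2 fun j =>
      h ω x j - M.postMean (designData a (observations h ε a ω)) x j)
      (multivariateGaussian 0 (M.postCov (designData a 0) x)) P := by
  classical
  let U : Fin m → Ω → ℝ := fun j ω => h ω x j
  let Y : Fin t × Fin m → Ω → ℝ := fun p ω => h ω (a p.1) p.2 + ε p.1 ω p.2
  have hG := M.hasGaussianLaw_prior_noise hh hε h_indep t
  have hUY : HasGaussianLaw (fun ω => (fun j => U j ω, fun p => Y p ω)) P := by
    let Λ : EuclideanSpace ℝ (𝒳 × Fin m) × (Fin t → EuclideanSpace ℝ (Fin m)) →L[ℝ]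
        (Fin m → ℝ) × (Fin t × Fin m → ℝ) :=
      LinearMap.toContinuousLinearMap
        { toFun := fun z => (fun j => z.1 (x, j), fun p => z.1 (a p.1, p.2) + z.2 p.1 p.2)
          map_add' := fun z w => by
            ext <;> simp
            ring
          map_smul' := fun c z => by
            ext <;> simp
            ring }
    exact hG.map_fun Λ
  have hmh (p : 𝒳 × Fin m) : MemLp (fun ω => h ω p.1 p.2) 2 P :=
    (hh.hasGaussianLaw.map_fun
      (EuclideanSpace.proj p : EuclideanSpace ℝ (𝒳 × Fin m) →L[ℝ] ℝ)).memLp_two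
  have hme (s : ℕ) (j : Fin m) : MemLp (fun ω => ε s ω j) 2 P :=
    ((hε.2 s).hasGaussianLaw.map_fun
      (EuclideanSpace.proj j : EuclideanSpace ℝ (Fin m) →L[ℝ] ℝ)).memLp_two
  have hhe (p : 𝒳 × Fin m) (s : ℕ) (j : Fin m) :
      cov[fun ω => h ω p.1 p.2, fun ω => ε s ω j; P] = 0 := by
    refine IndepFun.covariance_eq_zero ?_ (hmh p) (hme s j)
    exact h_indep.comp (φ := fun h : 𝒳 → Fin m → ℝ => h p.1 p.2)
      (ψ := fun e : ℕ → Fin m → ℝ => e s j) (by fun_prop) (by fun_prop)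
  have hYh (p : Fin t × Fin m) (q : 𝒳 × Fin m) :
      cov[Y p, fun ω => h ω q.1 q.2; P] = M.K₀ (a p.1, p.2) q := by
    have := covariance_add_left (hmh (a p.1, p.2)) (hme p.1 p.2) (hmh q)
    rw [M.covariance_prior hK hh, covariance_comm (fun ω => ε p.1 ω p.2), hhe, add_zero] at this
    exact this
  -- Rows are indexed by steps, not by points, so repeated queries of one point carry independent
  -- noise.
  have hYY (p q : Fin t × Fin m) : cov[Y p, Y q; P] =
      (M.gram (designData a 0) + M.σ ^ 2 • 1) p q := by
    have h1 := covariance_add_right (hUY.snd.eval p).memLp_two (hmh (a q.1, q.2)) (hme q.1 q.2)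
    have h2 := covariance_add_left (hmh (a p.1, p.2)) (hme p.1 p.2) (hme q.1 q.2)
    rw [M.covariance_noise hε, hhe, zero_add] at h2
    rw [hYh] at h1
    refine h1.trans ?_
    refine (congrArg _ h2).trans ?_
    simp [gram, designData, Matrix.one_apply, Prod.ext_iff, Fin.ext_iff]
  have hmean (p : 𝒳 × Fin m) : ∫ ω, h ω p.1 p.2 ∂P = M.μ₀ p.1 p.2 :=
    integral_eval_of_hasLaw hh p
  have hYmean (p : Fin t × Fin m) : ∫ ω, Y p ω ∂P = M.μ₀ (a p.1) p.2 := by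
    have h0 : ∫ ω, ε p.1 ω p.2 ∂P = 0 := integral_eval_of_hasLaw (hε.2 p.1) p.2
    have := integral_add ((hmh (a p.1, p.2)).integrable one_le_two)
      ((hme p.1 p.2).integrable one_le_two)
    rw [h0, hmean, add_zero] at this
    exact this
  obtain ⟨h1, h2⟩ := regression_residual hUY
    (M.posDef_gram_add hK hσ (designData a 0)).det_pos.ne'.isUnit
    (B := Matrix.of fun j k => M.K₀ (x, j) (x, k)) (C := M.crossCov (designData a 0) x)
    hYY (fun p j => hYh p (x, j)) (fun j k => M.covariance_prior hK hh (x, j) (x, k))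
    (M.posSemidef_postCov hK hσ (designData a 0) x) (fun j => hmean (x, j)) hYmean
  exact ⟨h1.comp (φ := id) (ψ := fun (y : Fin t × Fin m → ℝ) s j => y (s, j)) measurable_id
    (by fun_prop), h2⟩

end Model

end CUQB

/-! ### Conditional probability bounds at a fixed design -/

namespace CUQB

open Set

/-- Fubini on the product law. The factor `P {Y ∈ S}` is retained so that bounds over disjoint
events can later be summed. -/
theorem measure_indep_inter_le {Ω α β : Type*} [MeasurableSpace Ω] [MeasurableSpace α]
    [MeasurableSpace β] {P : Measure Ω} [IsProbabilityMeasure P] {R : Ω → α} {Y : Ω → β}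
    (hR : AEMeasurable R P) (hY : AEMeasurable Y P) (hRY : IndepFun R Y P) {B : Set (α × β)}
    (hB : MeasurableSet B) {q : ENNReal} (hq : ∀ y, P.map R {r | (r, y) ∈ B} ≤ q)
    {S : Set β} (hS : MeasurableSet S) :
    P {ω | Y ω ∈ S ∧ (R ω, Y ω) ∈ B} ≤ q * P {ω | Y ω ∈ S} := by
  have := Measure.isProbabilityMeasure_map hR
  have := Measure.isProbabilityMeasure_map hY
  have hmap := (indepFun_iff_map_prod_eq_prod_map_map hR hY).1 hRY
  have hBS : MeasurableSet (B ∩ Prod.snd ⁻¹' S) := hB.inter (measurable_snd hS)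
  have h1 : P {ω | Y ω ∈ S ∧ (R ω, Y ω) ∈ B} =
      P.map (fun ω => (R ω, Y ω)) (B ∩ Prod.snd ⁻¹' S) := by
    rw [Measure.map_apply_of_aemeasurable (hR.prodMk hY) hBS]
    congr 1
    ext ω
    exact and_comm
  rw [h1, hmap, Measure.prod_apply_symm hBS]
  calc ∫⁻ y, P.map R ((fun r => (r, y)) ⁻¹' (B ∩ Prod.snd ⁻¹' S)) ∂(P.map Y)
      ≤ ∫⁻ y, S.indicator (fun _ => q) y ∂(P.map Y) := by
        refine lintegral_mono fun y => ?_
        by_cases hy : y ∈ S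
        · rw [indicator_of_mem hy]
          exact (measure_mono fun r hr => hr.1).trans (hq y)
        · have : (fun r => (r, y)) ⁻¹' (B ∩ Prod.snd ⁻¹' S) = (∅ : Set α) := by
            ext r
            simp [hy]
          rw [this, measure_empty]
          exact zero_le
    _ = q * P {ω | Y ω ∈ S} := by
        rw [lintegral_indicator_const hS, Measure.map_apply_of_aemeasurable hY hS]
        rfl

namespace Model

variable {𝒳 : Type*} {n m t : ℕ} (M : Model 𝒳 n m)

theorem measurable_postMean_designData (a : Fin t → 𝒳) (x : 𝒳) :
    Measurable fun y => M.postMean (designData a y) x := by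
  have : Continuous fun y : Fin t → Fin m → ℝ => M.μ₀ x + Matrix.mulVec
      ((M.crossCov (designData a 0) x).transpose * (M.gram (designData a 0) + M.σ ^ 2 • 1)⁻¹)
      (fun p => y p.1 p.2 - M.μ₀ (a p.1) p.2) :=
    continuous_const.add (continuous_const.matrix_mulVec (by fun_prop))
  exact this.measurable

/-- The observations only shift the posterior, so all predictive laws are expressed through one
centred Gaussian, the law of the residual. -/
theorem predLaw_designData_apply {i : Fin (n + 1)} {x : 𝒳} (hg : Continuous (M.g i x))
    (a : Fin t → 𝒳) (y : Fin t → Fin m → ℝ) {s : Set ℝ} (hs : MeasurableSet s) :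
    M.predLaw (designData a y) i x s =
      multivariateGaussian 0 (M.postCov (designData a 0) x)
        {r | M.g i x (M.postMean (designData a y) x + r.ofLp) ∈ s} := by
  have hms : Measurable fun z : EuclideanSpace ℝ (Fin m) => M.g i x z.ofLp :=
    hg.measurable.comp (by fun_prop)
  have hshift : multivariateGaussian (WithLp.toLp 2 (M.postMean (designData a y) x))
      (M.postCov (designData a y) x) =
      (multivariateGaussian 0 (M.postCov (designData a 0) x)).map
        fun r => WithLp.toLp 2 (M.postMean (designData a y) x) + r := by
    rw [multivariateGaussian, multivariateGaussian, Measure.map_map (by fun_prop) (by fun_prop)]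
    simp only [Function.comp_def, zero_add]
    rfl
  rw [predLaw, hshift, Measure.map_map hms (by fun_prop),
    Measure.map_apply (hms.comp (by fun_prop)) hs]
  rfl

theorem measurable_quantile_predLaw {i : Fin (n + 1)} {x : 𝒳} (hg : Continuous (M.g i x))
    (a : Fin t → 𝒳) {p : ℝ} (hp0 : 0 < p) (hp1 : p < 1) :
    Measurable fun y => quantile (M.predLaw (designData a y) i x) p := by
  refine measurable_of_Iic fun c => ?_
  -- Sublevel sets of the quantile are conditions on the distribution function at `c`, which is the
  -- measure of a section of a measurable set and hence measurable in `y`.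
  have hset : (fun y => quantile (M.predLaw (designData a y) i x) p) ⁻¹' Iic c =
      {y | p ≤ (multivariateGaussian 0 (M.postCov (designData a 0) x)
        {r | M.g i x (M.postMean (designData a y) x + r.ofLp) ∈ Iic c}).toReal} := by
    ext y
    have := M.isProbabilityMeasure_predLaw hg (designData a y)
    rw [mem_preimage, mem_Iic, quantile_le_iff hp0 hp1, Measure.real,
      M.predLaw_designData_apply hg a y measurableSet_Iic]
    rfl
  rw [hset]
  refine measurableSet_le measurable_const (Measurable.ennreal_toReal ?_)
  have hB : MeasurableSet {z : (Fin t → Fin m → ℝ) × EuclideanSpace ℝ (Fin m) |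
      M.g i x (M.postMean (designData a z.1) x + z.2.ofLp) ∈ Iic c} := by
    have hmean := M.measurable_postMean_designData a x
    exact (hg.measurable.comp ((hmean.comp measurable_fst).add
      ((by fun_prop : Measurable fun z : EuclideanSpace ℝ (Fin m) => z.ofLp).comp
        measurable_snd))) measurableSet_Iic
  exact measurable_measure_prodMk_left hB

variable {Ω : Type*} [MeasurableSpace Ω] {P : Measure Ω} {h : Ω → 𝒳 → Fin m → ℝ}
  {ε : ℕ → Ω → Fin m → ℝ}

theorem measurable_observations (hh : Measurable h) (hε : ∀ t, Measurable (ε t))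
    (a : Fin t → 𝒳) : Measurable (observations h ε a) := by
  refine measurable_pi_iff.2 fun s => measurable_pi_iff.2 fun j => ?_
  have h1 := (measurable_pi_iff.1 ((measurable_pi_iff.1 hh) (a s))) j
  have h2 := (measurable_pi_iff.1 (hε s)) j
  exact h1.add h2

variable [Fintype 𝒳] [IsProbabilityMeasure P]

/-- Conditionally on the observations at a fixed design, `f i x` has the predictive law. -/
theorem measure_observations_inter_le (hK : M.K₀.PosSemidef) (hσ : 0 < M.σ)
    (hh_meas : Measurable h) (hh : M.IsGPSample P h)
    (hε_meas : ∀ t, Measurable (ε t)) (hε : M.IsNoise P ε)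
    (h_indep : IndepFun h (fun ω t => ε t ω) P) (a : Fin t → 𝒳) {i : Fin (n + 1)} {x : 𝒳}
    (hg : Continuous (M.g i x)) {V : (Fin t → Fin m → ℝ) → Set ℝ}
    (hV : MeasurableSet {z : ℝ × (Fin t → Fin m → ℝ) | z.1 ∈ V z.2}) {q : ENNReal}
    (hq : ∀ y, M.predLaw (designData a y) i x (V y) ≤ q)
    {S : Set (Fin t → Fin m → ℝ)} (hS : MeasurableSet S) :
    P {ω | observations h ε a ω ∈ S ∧ M.f (h ω) i x ∈ V (observations h ε a ω)} ≤
      q * P {ω | observations h ε a ω ∈ S} := by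
  obtain ⟨hind, hlaw⟩ := M.posterior_residual hK hσ hh hε h_indep a x
  have hmean := M.measurable_postMean_designData a x
  have hY := measurable_observations hh_meas hε_meas a
  have hR : Measurable fun ω j =>
      h ω x j - M.postMean (designData a (observations h ε a ω)) x j := by
    have h1 := (measurable_pi_iff.1 hh_meas) x
    exact h1.sub (hmean.comp hY)
  have hmap : Measurable fun z : (Fin m → ℝ) × (Fin t → Fin m → ℝ) =>
      (M.g i x (M.postMean (designData a z.2) x + z.1), z.2) :=
    (hg.measurable.comp ((hmean.comp measurable_snd).add measurable_fst)).prodMk measurable_snd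
  have hle := measure_indep_inter_le hR.aemeasurable hY.aemeasurable hind (hmap hV) (q := q)
    (fun y => ?_) hS
  · refine Eq.trans_le ?_ hle
    congr 1
    ext ω
    refine and_congr_right fun _ => ?_
    have : M.postMean (designData a (observations h ε a ω)) x + (fun j =>
        h ω x j - M.postMean (designData a (observations h ε a ω)) x j) = h ω x := by
      ext j
      simp
    simp only [mem_preimage, mem_ofPred_eq, this]
    rfl
  · refine le_trans (le_of_eq ?_) (hq y)
    have hVy : MeasurableSet (V y) := measurable_prodMk_right (y := y) hV
    rw [M.predLaw_designData_apply hg a y hVy, ← hlaw.map_eq,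
      Measure.map_apply_of_aemeasurable hlaw.aemeasurable, Measure.map_apply hR]
    · rfl
    · exact (hmap.comp measurable_prodMk_right) hV
    · exact (hg.measurable.comp ((by fun_prop : Measurable fun z : EuclideanSpace ℝ (Fin m) =>
        M.postMean (designData a y) x + z.ofLp))) hVy

end Model

end CUQB

namespace CUQB

open Set

/-! ### Adaptive designs -/

section Adaptive

variable {𝒳 : Type*} {m : ℕ} (A : Rule 𝒳 m)

theorem runData_apply (h : 𝒳 → Fin m → ℝ) (e : ℕ → Fin m → ℝ) (t : ℕ) (s : Fin t) :
    runData A h e t s = (query A h e s, h (query A h e s) + e s) := by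
  induction t with
  | zero => exact s.elim0
  | succ t ih =>
    refine Fin.lastCases ?_ (fun s => ?_) s
    · simp [runData, query]
    · simp only [runData, Fin.snoc_castSucc, ih, Fin.val_castSucc]

/-- The observation vectors on which the rule `A` produces the design `a`. -/
def consistentObservations {t : ℕ} (a : Fin t → 𝒳) : Set (Fin t → Fin m → ℝ) :=
  {y | ∀ s : Fin t, A s (fun s' : Fin s => (a (s'.castLE s.2.le), y (s'.castLE s.2.le))) = a s}

variable {Ω : Type*} {h : Ω → 𝒳 → Fin m → ℝ} {ε : ℕ → Ω → Fin m → ℝ}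

/-- Each query depends only on earlier data, so by strong induction the run and the fixed design `a`
agree step by step. The event that the run follows `a` is thus determined by the observations at
`a`. -/
theorem observations_mem_consistent_iff {t : ℕ} (a : Fin t → 𝒳) (ω : Ω) :
    Model.observations h ε a ω ∈ consistentObservations A a ↔
      (fun s : Fin t => query A (h ω) (fun s => ε s ω) s) = a := by
  have hrun (s : Fin t)
      (hs : ∀ s' : Fin s, query A (h ω) (fun s => ε s ω) s' = a (s'.castLE s.2.le)) :
      (fun s' : Fin s => (a (s'.castLE s.2.le),
        Model.observations h ε a ω (s'.castLE s.2.le))) =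
      runData A (h ω) (fun s => ε s ω) s := by
    ext1 s'
    rw [runData_apply, hs s']
    rfl
  constructor
  · intro hy
    have key : ∀ k (hk : k < t), query A (h ω) (fun s => ε s ω) k = a ⟨k, hk⟩ := by
      intro k
      induction k using Nat.strong_induction_on with
      | _ k ih =>
        intro hk
        have h1 := hy ⟨k, hk⟩
        rw [hrun ⟨k, hk⟩ fun s' => ih s' s'.2 _] at h1
        exact h1
    exact funext fun s => key s s.2
  · intro ha s
    rw [hrun s fun s' => congrFun ha (s'.castLE s.2.le)]
    exact congrFun ha s

theorem runData_eq_designData {t : ℕ} {a : Fin t → 𝒳} {ω : Ω}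
    (ha : (fun s : Fin t => query A (h ω) (fun s => ε s ω) s) = a) :
    runData A (h ω) (fun s => ε s ω) t = Model.designData a (Model.observations h ε a ω) := by
  ext1 s
  rw [runData_apply, congrFun ha s]
  rfl

theorem measurableSet_consistentObservations [MeasurableSpace 𝒳] [MeasurableSingletonClass 𝒳]
    (hA : ∀ t, Measurable (A t)) {t : ℕ} (a : Fin t → 𝒳) :
    MeasurableSet (consistentObservations A a) := by
  have : consistentObservations A a = ⋂ s : Fin t, (fun y : Fin t → Fin m → ℝ =>
      A s (fun s' : Fin s => (a (s'.castLE s.2.le), y (s'.castLE s.2.le)))) ⁻¹' {a s} := by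
    ext y
    simp [consistentObservations]
  rw [this]
  refine MeasurableSet.iInter fun s => ((hA s).comp ?_) (measurableSet_singleton _)
  exact measurable_pi_iff.2 fun s' => measurable_const.prodMk (measurable_pi_apply _)

variable [MeasurableSpace Ω] {P : Measure Ω} [IsProbabilityMeasure P]

/-- A conditional probability bound at all fixed designs carries over to adaptive designs. -/
theorem measure_runData_le [Fintype 𝒳] [MeasurableSpace 𝒳] [MeasurableSingletonClass 𝒳]
    (hA : ∀ t, Measurable (A t)) (hh : Measurable h) (hε : ∀ t, Measurable (ε t)) {t : ℕ}
    {Bad : Data 𝒳 m t → (𝒳 → Fin m → ℝ) → Prop} {q : ENNReal}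
    (hq : ∀ (a : Fin t → 𝒳) (S : Set (Fin t → Fin m → ℝ)), MeasurableSet S →
      P {ω | Model.observations h ε a ω ∈ S ∧
        Bad (Model.designData a (Model.observations h ε a ω)) (h ω)} ≤
      q * P {ω | Model.observations h ε a ω ∈ S}) :
    P {ω | Bad (runData A (h ω) (fun s => ε s ω) t) (h ω)} ≤ q := by
  classical
  -- The events `F a` are disjoint, one for each realized design, and on `F a` the adaptive data
  -- coincide with the data at the fixed design `a`.
  let F : (Fin t → 𝒳) → Set Ω :=
    fun a => {ω | Model.observations h ε a ω ∈ consistentObservations A a}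
  have hF (a : Fin t → 𝒳) : MeasurableSet (F a) :=
    Model.measurable_observations hh hε a (measurableSet_consistentObservations A hA a)
  have hdisj : Pairwise (Function.onFun Disjoint F) := by
    intro a b hab
    rw [Function.onFun, Set.disjoint_left]
    intro ω ha hb
    exact hab (((observations_mem_consistent_iff A a ω).1 ha).symm.trans
      ((observations_mem_consistent_iff A b ω).1 hb))
  calc P {ω | Bad (runData A (h ω) (fun s => ε s ω) t) (h ω)}
      ≤ P (⋃ a, {ω | Model.observations h ε a ω ∈ consistentObservations A a ∧
        Bad (Model.designData a (Model.observations h ε a ω)) (h ω)}) := by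
        refine measure_mono fun ω hω => mem_iUnion.2
          ⟨fun s : Fin t => query A (h ω) (fun s => ε s ω) s, ?_, ?_⟩
        · exact (observations_mem_consistent_iff A _ ω).2 rfl
        · rw [← runData_eq_designData A rfl]
          exact hω
    _ ≤ ∑ a, P {ω | Model.observations h ε a ω ∈ consistentObservations A a ∧
        Bad (Model.designData a (Model.observations h ε a ω)) (h ω)} :=
        measure_iUnion_fintype_le _ _
    _ ≤ ∑ a, q * P (F a) :=
        Finset.sum_le_sum fun a _ => hq a _ (measurableSet_consistentObservations A hA a)
    _ = q * P (⋃ a, F a) := by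
        rw [← Finset.mul_sum, measure_iUnion hdisj hF, tsum_fintype]
    _ ≤ q * 1 := by
        gcongr
        exact prob_le_one
    _ = q := mul_one q

end Adaptive

/-! ### The confidence event -/

namespace Model

variable {𝒳 : Type*} {n m : ℕ} (M : Model 𝒳 n m) [Fintype 𝒳]

theorem sum_level_le [Nonempty 𝒳] {δ : ℝ} (hδ : 0 ≤ δ) (T : ℕ) :
    ∑ t ∈ Finset.range T, ∑ _i : Fin (n + 1), ∑ _x : 𝒳, M.level δ t ≤ δ := by
  have hX : (0 : ℝ) < Fintype.card 𝒳 := by exact_mod_cast Fintype.card_pos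
  have hterm (t : ℕ) : ∑ _i : Fin (n + 1), ∑ _x : 𝒳, M.level δ t =
      6 * δ / Real.pi ^ 2 * (1 / ((t + 1 : ℕ) : ℝ) ^ 2) := by
    simp only [Finset.sum_const, Finset.card_univ, Fintype.card_fin, nsmul_eq_mul, level]
    push_cast
    field_simp
  have hsum : ∑ t ∈ Finset.range T, 1 / ((t + 1 : ℕ) : ℝ) ^ 2 ≤ Real.pi ^ 2 / 6 := by
    -- The series is indexed from `0`, where its term `1 / 0 ^ 2` is `0`.
    have h := sum_le_hasSum (Finset.range (T + 1)) (fun i _ => by positivity) hasSum_zeta_two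
    rw [Finset.sum_range_succ'] at h
    simpa using h
  calc ∑ t ∈ Finset.range T, ∑ _i : Fin (n + 1), ∑ _x : 𝒳, M.level δ t
      = 6 * δ / Real.pi ^ 2 * ∑ t ∈ Finset.range T, 1 / ((t + 1 : ℕ) : ℝ) ^ 2 := by
        rw [Finset.mul_sum]
        exact Finset.sum_congr rfl fun t _ => hterm t
    _ ≤ 6 * δ / Real.pi ^ 2 * (Real.pi ^ 2 / 6) := by gcongr
    _ = δ := by
        field_simp

variable {Ω : Type*} [MeasurableSpace Ω] {P : Measure Ω} [IsProbabilityMeasure P]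
  {h : Ω → 𝒳 → Fin m → ℝ} {ε : ℕ → Ω → Fin m → ℝ}

theorem measure_notMem_interval_le [Nonempty 𝒳] [MeasurableSpace 𝒳] [MeasurableSingletonClass 𝒳]
    (hK : M.K₀.PosSemidef) (hσ : 0 < M.σ) (hg : ∀ i x, Continuous (M.g i x))
    (hh_meas : Measurable h) (hh : M.IsGPSample P h)
    (hε_meas : ∀ t, Measurable (ε t)) (hε : M.IsNoise P ε)
    (h_indep : IndepFun h (fun ω t => ε t ω) P)
    {A : Rule 𝒳 m} (hA : ∀ t, Measurable (A t)) {δ : ℝ} (hδ : 0 < δ) (hδ1 : δ < 1)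
    (t : ℕ) (i : Fin (n + 1)) (x : 𝒳) :
    P {ω | M.f (h ω) i x ∉ Icc (M.lower δ (runData A (h ω) (fun s => ε s ω) t) i x)
      (M.upper δ (runData A (h ω) (fun s => ε s ω) t) i x)} ≤ ENNReal.ofReal (M.level δ t) := by
  have hα := M.level_pos hδ t
  have hα1 := M.level_lt_one hδ hδ1 t
  refine measure_runData_le A hA hh_meas hε_meas
    (Bad := fun D h => M.f h i x ∉ Icc (M.lower δ D i x) (M.upper δ D i x)) fun a S hS => ?_
  refine M.measure_observations_inter_le hK hσ hh_meas hh hε_meas hε h_indep a (hg i x)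
    (V := fun y => (Icc (M.lower δ (designData a y) i x) (M.upper δ (designData a y) i x))ᶜ)
    ?_ (fun y => ?_) hS
  · have hl := M.measurable_quantile_predLaw (hg i x) a (p := M.level δ t / 2) (by linarith)
      (by linarith)
    have hu := M.measurable_quantile_predLaw (hg i x) a (p := 1 - M.level δ t / 2) (by linarith)
      (by linarith)
    exact ((measurableSet_le (hl.comp measurable_snd) measurable_fst).inter
      (measurableSet_le measurable_fst (hu.comp measurable_snd))).compl
  · have := M.isProbabilityMeasure_predLaw (hg i x) (designData a y)
    rw [← ofReal_measureReal]
    refine ENNReal.ofReal_le_ofReal ?_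
    have hl := measureReal_Iio_quantile_le (ν := M.predLaw (designData a y) i x)
      (p := M.level δ t / 2) (by linarith) (by linarith)
    have hu := measureReal_Ioi_quantile_le (ν := M.predLaw (designData a y) i x)
      (p := 1 - M.level δ t / 2) (by linarith) (by linarith)
    calc (M.predLaw (designData a y) i x).real
          (Icc (M.lower δ (designData a y) i x) (M.upper δ (designData a y) i x))ᶜ
        ≤ (M.predLaw (designData a y) i x).real
          (Iio (M.lower δ (designData a y) i x) ∪ Ioi (M.upper δ (designData a y) i x)) := by
          refine measureReal_mono fun z hz => ?_
          by_contra hcon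
          simp only [mem_union, mem_Iio, mem_Ioi, not_or, not_lt] at hcon
          exact hz hcon
      _ ≤ _ := measureReal_union_le _ _
      _ ≤ M.level δ t / 2 + (1 - (1 - M.level δ t / 2)) := add_le_add hl hu
      _ = M.level δ t := by ring

theorem exists_confidence_event [Nonempty 𝒳] [MeasurableSpace 𝒳] [MeasurableSingletonClass 𝒳]
    (hK : M.K₀.PosSemidef) (hσ : 0 < M.σ) (hg : ∀ i x, Continuous (M.g i x))
    (hh_meas : Measurable h) (hh : M.IsGPSample P h)
    (hε_meas : ∀ t, Measurable (ε t)) (hε : M.IsNoise P ε)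
    (h_indep : IndepFun h (fun ω t => ε t ω) P)
    {A : Rule 𝒳 m} (hA : ∀ t, Measurable (A t)) {δ : ℝ} (hδ : 0 < δ) (hδ1 : δ < 1) (T : ℕ) :
    ∃ E : Set Ω, MeasurableSet E ∧ 1 - δ ≤ P.real E ∧ ∀ ω ∈ E, ∀ t < T, ∀ i x,
      M.f (h ω) i x ∈ Icc (M.lower δ (runData A (h ω) (fun s => ε s ω) t) i x)
        (M.upper δ (runData A (h ω) (fun s => ε s ω) t) i x) := by
  let bad (t : ℕ) (i : Fin (n + 1)) (x : 𝒳) : Set Ω :=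
    {ω | M.f (h ω) i x ∉ Icc (M.lower δ (runData A (h ω) (fun s => ε s ω) t) i x)
      (M.upper δ (runData A (h ω) (fun s => ε s ω) t) i x)}
  let B : Set Ω := ⋃ t ∈ Finset.range T, ⋃ i, ⋃ x, bad t i x
  have hB : P B ≤ ENNReal.ofReal δ := by
    calc P B ≤ ∑ t ∈ Finset.range T, P (⋃ i, ⋃ x, bad t i x) := measure_biUnion_finset_le _ _
      _ ≤ ∑ t ∈ Finset.range T, ∑ i : Fin (n + 1), ∑ x : 𝒳, P (bad t i x) :=
          Finset.sum_le_sum fun t _ => (measure_iUnion_fintype_le _ _).trans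
            (Finset.sum_le_sum fun i _ => measure_iUnion_fintype_le _ _)
      _ ≤ ∑ t ∈ Finset.range T, ∑ i : Fin (n + 1), ∑ x : 𝒳, ENNReal.ofReal (M.level δ t) :=
          Finset.sum_le_sum fun t _ => Finset.sum_le_sum fun i _ => Finset.sum_le_sum fun x _ =>
            M.measure_notMem_interval_le hK hσ hg hh_meas hh hε_meas hε h_indep hA hδ hδ1 t i x
      _ = ENNReal.ofReal (∑ t ∈ Finset.range T, ∑ i : Fin (n + 1), ∑ x : 𝒳, M.level δ t) := by
          have h0 (t : ℕ) : 0 ≤ M.level δ t := (M.level_pos hδ t).le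
          rw [ENNReal.ofReal_sum_of_nonneg fun t _ => Finset.sum_nonneg fun i _ =>
            Finset.sum_nonneg fun x _ => h0 t]
          refine Finset.sum_congr rfl fun t _ => ?_
          rw [ENNReal.ofReal_sum_of_nonneg fun i _ => Finset.sum_nonneg fun x _ => h0 t]
          refine Finset.sum_congr rfl fun i _ => ?_
          rw [ENNReal.ofReal_sum_of_nonneg fun x _ => h0 t]
      _ ≤ ENNReal.ofReal δ := ENNReal.ofReal_le_ofReal (M.sum_level_le hδ.le T)
  -- A measurable hull of the bad set has the same measure, which avoids proving `B` measurable.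
  refine ⟨(toMeasurable P B)ᶜ, (measurableSet_toMeasurable P B).compl, ?_, ?_⟩
  · rw [probReal_compl_eq_one_sub (measurableSet_toMeasurable P B), Measure.real,
      measure_toMeasurable]
    exact sub_le_sub_left (ENNReal.toReal_le_of_le_ofReal hδ.le hB) 1
  · intro ω hω t ht i x
    by_contra hcon
    refine hω (subset_toMeasurable P B ?_)
    simp only [B, mem_iUnion, Finset.mem_range]
    exact ⟨t, ht, i, x, hcon⟩

end Model

end CUQB

namespace CUQB

open Set

/-! ### Regret -/

theorem violation_eq_zero {𝒳 : Type*} {n : ℕ} {f : Fin (n + 1) → 𝒳 → ℝ} {x : 𝒳}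
    (hx : IsFeasible f x) : violation f x = 0 :=
  Finset.sum_eq_zero fun i _ => max_eq_right (neg_nonpos.2 (hx i))

theorem penalized_mono {𝒳 : Type*} {n : ℕ} {f f' : Fin (n + 1) → 𝒳 → ℝ} {x : 𝒳} {ρ : ℝ}
    (hρ : 0 ≤ ρ) (hf : ∀ i, f i x ≤ f' i x) : penalized f ρ x ≤ penalized f' ρ x := by
  have : violation f' x ≤ violation f x :=
    Finset.sum_le_sum fun i _ => max_le_max (neg_le_neg (hf i.succ)) le_rfl
  exact sub_le_sub (hf 0) (mul_le_mul_of_nonneg_left this hρ)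

namespace Model

variable {𝒳 : Type*} {n m : ℕ} (M : Model 𝒳 n m) [Fintype 𝒳]

/-- Optimism: `xstar` is feasible for the upper bounds, so the selected point has `u_0` at least the
value of `f 0` at `xstar`. Its own feasibility `u_i ≥ 0` bounds each violation `[-l_i]⁺` by the
width `u_i - l_i`. -/
theorem optimum_sub_penalized_lower_le [Nonempty 𝒳] [MeasurableSpace 𝒳] (hm : 0 < m)
    (hK : M.K₀.PosSemidef) (hσ : 0 < M.σ) {L : Fin (n + 1) → ℝ}
    (hL : ∀ i x (y z : Fin m → ℝ), |M.g i x y - M.g i x z| ≤ L i * ∑ j : Fin m, |y j - z j|)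
    {δ : ℝ} (hδ : 0 < δ) (hδ1 : δ < 1) {A : Rule 𝒳 m} (hA : M.IsCUQBRule δ A)
    {h : 𝒳 → Fin m → ℝ} {t T : ℕ} (ht : t < T) {D : Data 𝒳 m t}
    (hconf : ∀ i x, M.f h i x ∈ Icc (M.lower δ D i x) (M.upper δ D i x)) {xstar : 𝒳}
    (hx : IsFeasible (M.f h) xstar) {ρ : ℝ} (hρ : 0 ≤ ρ) :
    M.f h 0 xstar - penalized (M.lower δ D) ρ (A t D) ≤
      2 * (L 0 + ρ * ∑ i : Fin n, L i.succ) * Real.sqrt (M.beta δ T) *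
        ∑ j, Real.sqrt (M.outputVar j (fun s => (D s).1) (A t D)) := by
  have hfeas : IsFeasible (M.upper δ D) xstar := fun i => (hx i).trans (hconf i.succ xstar).2
  have hsol := hA.2 t D ⟨xstar, hfeas⟩
  set x := A t D with hxdef
  have h0 : M.f h 0 xstar ≤ M.upper δ D 0 x := (hconf 0 xstar).2.trans (hsol.2 xstar hfeas)
  have hwidth (i : Fin (n + 1)) := M.upper_sub_lower_le hm hK hσ (hL i x) hδ hδ1 ht D
  have hviol : violation (M.lower δ D) x ≤
      ∑ i : Fin n, 2 * L i.succ * Real.sqrt (M.beta δ T) *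
        ∑ j, Real.sqrt (M.postCov D x j j) := by
    refine Finset.sum_le_sum fun i _ => max_le ?_ ?_
    · linarith [hwidth i.succ, hsol.1 i]
    · have := hconf i.succ x
      linarith [hwidth i.succ, this.1.trans this.2]
  have hS : ∑ j, Real.sqrt (M.postCov D x j j) ≤
      ∑ j, Real.sqrt (M.outputVar j (fun s => (D s).1) x) :=
    Finset.sum_le_sum fun j _ => Real.sqrt_le_sqrt (M.postCov_diag_le_outputVar hK hσ D x j)
  have hL0 (i : Fin (n + 1)) : 0 ≤ L i := lipschitz_const_nonneg hm (hL i x)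
  have hLsum : 0 ≤ L 0 + ρ * ∑ i : Fin n, L i.succ :=
    add_nonneg (hL0 0) (mul_nonneg hρ (Finset.sum_nonneg fun i _ => hL0 i.succ))
  calc M.f h 0 xstar - penalized (M.lower δ D) ρ x
      = M.f h 0 xstar - M.lower δ D 0 x + ρ * violation (M.lower δ D) x := by
        rw [penalized]
        ring
    _ ≤ 2 * L 0 * Real.sqrt (M.beta δ T) * ∑ j, Real.sqrt (M.postCov D x j j) +
        ρ * ∑ i : Fin n, 2 * L i.succ * Real.sqrt (M.beta δ T) *
          ∑ j, Real.sqrt (M.postCov D x j j) :=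
        add_le_add (by linarith [hwidth 0]) (mul_le_mul_of_nonneg_left hviol hρ)
    _ = 2 * (L 0 + ρ * ∑ i : Fin n, L i.succ) * Real.sqrt (M.beta δ T) *
        ∑ j, Real.sqrt (M.postCov D x j j) := by
        rw [← Finset.sum_mul, ← Finset.sum_mul, ← Finset.mul_sum]
        ring
    _ ≤ _ := mul_le_mul_of_nonneg_left hS (by positivity)

theorem sum_sum_sqrt_outputVar_le (hK : M.K₀.PosSemidef)
    (hK_le : ∀ (x : 𝒳) (j : Fin m), M.K₀ (x, j) (x, j) ≤ 1) {T : ℕ} (hT : 1 ≤ T) (hσ : 0 < M.σ)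
    (hσ_le : M.σ ^ 2 ≤ 1 + 2 / (T : ℝ)) (a : ℕ → 𝒳) :
    ∑ t ∈ Finset.range T, ∑ j, Real.sqrt (M.outputVar j (fun s : Fin t => a s) (a t)) ≤
      2 * M.Psi T := by
  rw [Finset.sum_comm, Psi, Finset.mul_sum]
  exact Finset.sum_le_sum fun j _ => M.sum_sqrt_outputVar_le hK hK_le hT hσ hσ_le j a

/-- The true penalty function at the recommended point dominates its lower bound there, which is the
largest along the run. The regret is thus below every single-step bound, hence below their average.
-/
theorem optimum_sub_penalized_recommended_le [Nonempty 𝒳] [MeasurableSpace 𝒳] (hm : 0 < m)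
    (hK : M.K₀.PosSemidef) (hK_le : ∀ (x : 𝒳) (j : Fin m), M.K₀ (x, j) (x, j) ≤ 1)
    {T : ℕ} (hT : 1 ≤ T) (hσ : 0 < M.σ) (hσ_le : M.σ ^ 2 ≤ 1 + 2 / (T : ℝ))
    {L : Fin (n + 1) → ℝ}
    (hL : ∀ i x (y z : Fin m → ℝ), |M.g i x y - M.g i x z| ≤ L i * ∑ j : Fin m, |y j - z j|)
    {δ : ℝ} (hδ : 0 < δ) (hδ1 : δ < 1) {A : Rule 𝒳 m} (hA : M.IsCUQBRule δ A)
    {h : 𝒳 → Fin m → ℝ} {e : ℕ → Fin m → ℝ}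
    (hconf : ∀ t < T, ∀ i x, M.f h i x ∈
      Icc (M.lower δ (runData A h e t) i x) (M.upper δ (runData A h e t) i x))
    {xstar : 𝒳} (hx : IsFeasible (M.f h) xstar) {ρ : ℝ} (hρ : 0 ≤ ρ) {τ : ℕ}
    (hτ : M.IsRecommended δ A h e T ρ τ) :
    M.f h 0 xstar - penalized (M.f h) ρ (query A h e τ) ≤
      4 * (L 0 + ρ * ∑ i : Fin n, L i.succ) * Real.sqrt (M.beta δ T) * M.Psi T / T := by
  have hT0 : (0 : ℝ) < T := by exact_mod_cast hT
  set C := 2 * (L 0 + ρ * ∑ i : Fin n, L i.succ) * Real.sqrt (M.beta δ T) with hC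
  have hL0 (i : Fin (n + 1)) : 0 ≤ L i := lipschitz_const_nonneg hm (hL i xstar)
  have hC0 : 0 ≤ C := mul_nonneg (mul_nonneg zero_le_two (add_nonneg (hL0 0)
    (mul_nonneg hρ (Finset.sum_nonneg fun i _ => hL0 i.succ)))) (Real.sqrt_nonneg _)
  have hstep (t : ℕ) (ht : t < T) :
      M.f h 0 xstar - penalized (M.f h) ρ (query A h e τ) ≤
        C * ∑ j, Real.sqrt (M.outputVar j (fun s : Fin t => query A h e s) (query A h e t)) := by
    have h1 := M.optimum_sub_penalized_lower_le hm hK hσ hL hδ hδ1 hA ht (hconf t ht) hx hρ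
    have h2 := hτ.2 t ht
    have h3 : penalized (M.lower δ (runData A h e τ)) ρ (query A h e τ) ≤
        penalized (M.f h) ρ (query A h e τ) :=
      penalized_mono hρ fun i => (hconf τ hτ.1 i _).1
    simp only [runData_apply] at h1
    refine le_trans ?_ h1
    exact sub_le_sub_left (h2.trans h3) _
  rw [le_div_iff₀ hT0]
  calc (M.f h 0 xstar - penalized (M.f h) ρ (query A h e τ)) * T
      = ∑ _t ∈ Finset.range T, (M.f h 0 xstar - penalized (M.f h) ρ (query A h e τ)) := by
        rw [Finset.sum_const, Finset.card_range, nsmul_eq_mul, mul_comm]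
    _ ≤ ∑ t ∈ Finset.range T,
        C * ∑ j, Real.sqrt (M.outputVar j (fun s : Fin t => query A h e s) (query A h e t)) :=
        Finset.sum_le_sum fun t ht => hstep t (Finset.mem_range.1 ht)
    _ ≤ C * (2 * M.Psi T) := by
        rw [← Finset.mul_sum]
        exact mul_le_mul_of_nonneg_left
          (M.sum_sum_sqrt_outputVar_le hK hK_le hT hσ hσ_le (query A h e)) hC0
    _ = 4 * (L 0 + ρ * ∑ i : Fin n, L i.succ) * Real.sqrt (M.beta δ T) * M.Psi T := by
        rw [hC]
        ring

end Model

end CUQB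

/-! ### The main theorem -/

theorem mainTheorem3 {d n m : ℕ} (hm : 0 < m)
    (X : Finset (EuclideanSpace ℝ (Fin d))) (M : CUQB.Model X n m)
    (hK : M.K₀.PosSemidef) (hK_le : ∀ (x : X) (j : Fin m), M.K₀ (x, j) (x, j) ≤ 1)
    (L : Fin (n + 1) → ℝ)
    (hL : ∀ (i : Fin (n + 1)) (x : X) (y z : Fin m → ℝ),
      |M.g i x y - M.g i x z| ≤ L i * ∑ j : Fin m, |y j - z j|)
    (T : ℕ) (hT : 1 ≤ T) (hσ : 0 < M.σ) (hσ_le : M.σ ^ 2 ≤ 1 + 2 / (T : ℝ))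
    (δ : ℝ) (hδ0 : 0 < δ) (hδ1 : δ < 1)
    {Ω : Type*} [MeasurableSpace Ω] (P : Measure Ω) [IsProbabilityMeasure P]
    (h : Ω → X → Fin m → ℝ) (hh_meas : Measurable h) (hh : M.IsGPSample P h)
    (ε : ℕ → Ω → Fin m → ℝ) (hε_meas : ∀ t, Measurable (ε t)) (hε : M.IsNoise P ε)
    (h_indep : IndepFun h (fun ω t => ε t ω) P)
    (A : CUQB.Rule X m) (hA : M.IsCUQBRule δ A) :
    ∃ E : Set Ω, MeasurableSet E ∧ 1 - δ ≤ P.real E ∧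
      ∀ ω ∈ E, ∀ xstar : X, CUQB.IsSolution (M.f (h ω)) xstar →
        (∀ t < T,
          ¬ M.DeclaresInfeasible δ (CUQB.runData A (h ω) (fun s => ε s ω) t) ∧
          ∃ x, CUQB.IsFeasible (M.upper δ (CUQB.runData A (h ω) (fun s => ε s ω) t)) x) ∧
        ∀ ρbar : ℝ, 0 ≤ ρbar →
          (∀ ρ, ρbar ≤ ρ → CUQB.IsExactPenalty (M.f (h ω)) ρ) →
          ∀ ρ, ρbar ≤ ρ → ∀ τ : ℕ,
            M.IsRecommended δ A (h ω) (fun s => ε s ω) T ρ τ →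
            0 ≤ M.f (h ω) 0 xstar
                - M.f (h ω) 0 (CUQB.query A (h ω) (fun s => ε s ω) τ)
                + ρ * CUQB.violation (M.f (h ω)) (CUQB.query A (h ω) (fun s => ε s ω) τ) ∧
            M.f (h ω) 0 xstar
                - M.f (h ω) 0 (CUQB.query A (h ω) (fun s => ε s ω) τ)
                + ρ * CUQB.violation (M.f (h ω)) (CUQB.query A (h ω) (fun s => ε s ω) τ)
              ≤ 4 * (L 0 + ρ * ∑ i : Fin n, L i.succ) * Real.sqrt (M.beta δ T) * M.Psi T
                  / (T : ℝ) := by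
  -- The rule must return a point even on empty data.
  have : Nonempty X := ⟨A 0 fun s => s.elim0⟩
  obtain ⟨E, hE, hPE, hconf⟩ := M.exists_confidence_event hK hσ
    (fun i x => CUQB.continuous_of_abs_sub_le (hL i x)) hh_meas hh hε_meas hε h_indep hA.1
    hδ0 hδ1 T
  refine ⟨E, hE, hPE, fun ω hω xstar hx => ⟨fun t ht => ?_, ?_⟩⟩
  · have hu (i : Fin (n + 1)) := (hconf ω hω t ht i xstar).2
    exact ⟨fun ⟨i, hi⟩ => absurd ((hx.1 i).trans (hu i.succ)) (not_le.2 (hi xstar)),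
      xstar, fun i => (hx.1 i).trans (hu i.succ)⟩
  · intro ρbar hρbar hexact ρ hρ τ hτ
    have hle := M.optimum_sub_penalized_recommended_le hm hK hK_le hT hσ hσ_le hL hδ0 hδ1 hA
      (hconf ω hω) hx.1 (hρbar.trans hρ) hτ
    -- Exactness gives the lower bound `0`, since the penalty vanishes at the feasible point
    -- `xstar`.
    have hpen := hexact ρ hρ xstar hx (CUQB.query A (h ω) (fun s => ε s ω) τ)
    rw [CUQB.penalized] at hle
    rw [CUQB.penalized, CUQB.penalized, CUQB.violation_eq_zero hx.1] at hpen
    constructor <;> linarith
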